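/- Let $K$ be an abelian Lie group (finite-dimensional, real, with countably many connected components), and write $\hat K$ for its Pontryagin dual. An alternating bicharacter is a map $e\colon K\times K\to U(1)$ that is a homomorphism in each variable separately and satisfies $e(k,k)=1$ for all $k\in K$; it is non-degenerate if $l\mapsto e(\cdot,l)$ is an isomorphism of topological groups $K\to\hat K$. (1) Let $e\colon K\times K\to U(1)$ be a non-degenerate alternating bicharacter. Then there exist an abelian Lie group $A$ (with countably many connected components) and an isomorphism of topological groups $\phi\colon A\times\hat A\to K$ such that $$e(\phi(x,\chi),\phi(x',\chi'))=\chi'(x)\,\chi(x')^{-1}\qquad\text{for all }x,x'\in A,\ \chi,\chi'\in\hat A.$$ (2) Consequently every Heisenberg group whose phase space is an abelian Lie group is isomorphic to a standard Heisenberg group. That is, let $G$ be a locally compact Hausdorff group and $1\to U(1)\xrightarrow{i}G\xrightarrow{\pi}K\to 1$ a central extension of topological groups ($i$ is continuous, and $\pi$ is continuous and open) such that the bicharacter $e$ of $K$ determined by $i(e(\pi(g),\pi(h)))=ghg^{-1}h^{-1}$ is non-degenerate. Then there exist an abelian Lie group $A$ (with countably many connected components), an isomorphism of topological groups $\phi\colon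 A\times\hat A\to K$, and an isomorphism of topological groups $\Psi\colon H(A)\to G$ with $\Psi(zI)=i(z)$ and $\pi(\Psi(zT_xM_\chi))=\phi(x,\chi)$ for all $z\in U(1)$, $x\in A$, $\chi\in\hat A$. Here $H(A)=\{zT_xM_\chi : z\in U(1),\ x\in A,\ \chi\in\hat A\}$ is the standard Heisenberg group of $A$, a group of unitary operators on $L^2(A)$ (with respect to Haar measure) with the strong operator topology, where, writing $A$ additively, $T_xf(y)=f(y-x)$ and $M_\chi f(y)=\chi(y)f(y)$. -/

import Mathlib

open MeasureTheory
open scoped Manifold ContDiff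

/-- A topological group is a (finite-dimensional, real) Lie group with countably many connected
components: it is Hausdorff, has countably many components, and admits an atlas modelled on some
`ℝⁿ` for which multiplication and inversion are smooth. -/
structure IsLieGroup (G : Type*) [Group G] [TopologicalSpace G] : Prop where
  t2 : T2Space G
  countable_components : Countable (ConnectedComponents G)
  exists_smooth_structure : ∃ (n : ℕ) (_ : ChartedSpace (EuclideanSpace ℝ (Fin n)) G),
    LieGroup (𝓡 n) ∞ G

section Bicharacter

variable {K : Type*} [CommGroup K] [TopologicalSpace K]

/-- `e` is a homomorphism in each variable separately, and `e (k, k) = 1` for all `k`. -/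
structure IsAlternatingBicharacter (e : K → K → Circle) : Prop where
  mul_left : ∀ k k' l, e (k * k') l = e k l * e k' l
  mul_right : ∀ k l l', e k (l * l') = e k l * e k l'
  alternating : ∀ k, e k k = 1

/-- `l ↦ e (·, l)` is an isomorphism of topological groups from `K` onto its Pontryagin dual
(in particular each `e (·, l)` is continuous). -/
def IsNondegenerateBicharacter (e : K → K → Circle) : Prop :=
  ∃ flat : K ≃ₜ* PontryaginDual K, ∀ k l, flat l k = e k l

end Bicharacter

section CentralExtension

variable {G K : Type*} [Group G] [TopologicalSpace G] [CommGroup K] [TopologicalSpace K]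

/-- The short exact sequence `1 → U(1) → G → K → 1` is a central extension of topological groups:
the image of `U(1)` is central, the inclusion is continuous, and `K` carries the quotient
topology. -/
structure IsTopologicalCentralExtension (S : GroupExtension Circle G K) : Prop where
  central : ∀ z g, S.inl z * g = g * S.inl z
  continuous_inl : Continuous S.inl
  isOpenQuotientMap_rightHom : IsOpenQuotientMap S.rightHom

/-- `e` is the commutator form of the extension: the commutator of `g` and `h` in `G` is the
element `e (π g, π h)` of `U(1)`. -/
def IsCommutatorForm (S : GroupExtension Circle G K) (e : K → K → Circle) : Prop :=
  ∀ g h, S.inl (e (S.rightHom g) (S.rightHom h)) = g * h * g⁻¹ * h⁻¹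

/-- The extension is a Heisenberg group with phase space `K`: it is a central extension of
topological groups whose commutator form is non-degenerate. -/
structure IsHeisenbergGroup (S : GroupExtension Circle G K) : Prop where
  isTopologicalCentralExtension : IsTopologicalCentralExtension S
  nondegenerate : ∃ e : K → K → Circle, IsCommutatorForm S e ∧ IsNondegenerateBicharacter e

end CentralExtension

namespace Heisenberg

noncomputable section

variable (A : Type*) [CommGroup A] [TopologicalSpace A] [IsTopologicalGroup A]
  [LocallyCompactSpace A] [MeasurableSpace A] [BorelSpace A]

/-- `L²(A)` with respect to Haar measure. -/
abbrev L2 := Lp ℂ 2 (Measure.haar : Measure A)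

variable {A}

/-- Multiplication by a scalar `z ∈ U(1)` as a unitary operator. -/
def scalar (z : Circle) : L2 A ≃ₗᵢ[ℂ] L2 A where
  toFun f := (z : ℂ) • f
  invFun f := ((z⁻¹ : Circle) : ℂ) • f
  map_add' f g := smul_add _ f g
  map_smul' c f := smul_comm _ c f
  left_inv f := by
    change ((z⁻¹ : Circle) : ℂ) • (z : ℂ) • f = f
    rw [smul_smul, ← Circle.coe_mul, inv_mul_cancel, Circle.coe_one, one_smul]
  right_inv f := by
    change (z : ℂ) • ((z⁻¹ : Circle) : ℂ) • f = f
    rw [smul_smul, ← Circle.coe_mul, mul_inv_cancel, Circle.coe_one, one_smul]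
  norm_map' f := by
    change ‖(z : ℂ) • f‖ = ‖f‖
    rw [norm_smul, Circle.norm_coe, one_mul]

/-- The translation operator `(T_x f)(y) = f (x⁻¹ y)`. -/
def translation (x : A) : L2 A ≃ₗᵢ[ℂ] L2 A where
  toFun := Lp.compMeasurePreserving (x⁻¹ * ·) (measurePreserving_mul_left Measure.haar x⁻¹)
  invFun := Lp.compMeasurePreserving (x * ·) (measurePreserving_mul_left Measure.haar x)
  map_add' f g := map_add _ f g
  map_smul' c f := (Lp.compMeasurePreservingₗ ℂ (x⁻¹ * ·)
    (measurePreserving_mul_left Measure.haar x⁻¹)).map_smul c f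
  left_inv f := by
    rw [← Lp.compMeasurePreserving_comp_apply]
    have h : (x⁻¹ * ·) ∘ (x * ·) = (id : A → A) := funext fun y => inv_mul_cancel_left x y
    simp only [h]
    exact Lp.compMeasurePreserving_id_apply f
  right_inv f := by
    rw [← Lp.compMeasurePreserving_comp_apply]
    have h : (x * ·) ∘ (x⁻¹ * ·) = (id : A → A) := funext fun y => mul_inv_cancel_left x y
    simp only [h]
    exact Lp.compMeasurePreserving_id_apply f
  norm_map' f := Lp.norm_compMeasurePreserving f _

theorem memLp_modulation (χ : PontryaginDual A) (f : L2 A) :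
    MemLp (fun y => (χ y : ℂ) * f y) 2 Measure.haar := by
  have hc : Continuous fun y => (χ y : ℂ) := continuous_subtype_val.comp (map_continuous χ)
  refine (Lp.memLp f).of_le (hc.aestronglyMeasurable.mul (Lp.aestronglyMeasurable f)) ?_
  exact Filter.Eventually.of_forall fun y => by
    rw [norm_mul, Circle.norm_coe, one_mul]

/-- The pointwise product `χ f` in `L²(A)`. -/
def modulationFun (χ : PontryaginDual A) (f : L2 A) : L2 A :=
  (memLp_modulation χ f).toLp

theorem coeFn_modulationFun (χ : PontryaginDual A) (f : L2 A) :
    modulationFun χ f =ᵐ[Measure.haar] fun y => (χ y : ℂ) * f y :=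
  MemLp.coeFn_toLp _

theorem modulationFun_mul (χ χ' : PontryaginDual A) (f : L2 A) :
    modulationFun χ (modulationFun χ' f) = modulationFun (χ * χ') f := by
  apply Lp.ext
  filter_upwards [coeFn_modulationFun χ (modulationFun χ' f), coeFn_modulationFun χ' f,
    coeFn_modulationFun (χ * χ') f] with y h1 h2 h3
  rw [h1, h2, h3, ← mul_assoc, ← Circle.coe_mul]
  rfl

theorem modulationFun_one (f : L2 A) : modulationFun 1 f = f := by
  apply Lp.ext
  filter_upwards [coeFn_modulationFun 1 f] with y h1
  rw [h1, PontryaginDual.one_apply, Circle.coe_one, one_mul]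

/-- The modulation operator `(M_χ f)(y) = χ(y) f(y)`. -/
def modulation (χ : PontryaginDual A) : L2 A ≃ₗᵢ[ℂ] L2 A where
  toFun := modulationFun χ
  invFun := modulationFun χ⁻¹
  map_add' f g := by
    apply Lp.ext
    filter_upwards [coeFn_modulationFun χ (f + g), coeFn_modulationFun χ f,
      coeFn_modulationFun χ g, Lp.coeFn_add f g,
      Lp.coeFn_add (modulationFun χ f) (modulationFun χ g)] with y h1 h2 h3 h4 h5
    rw [h1, h5, h4, Pi.add_apply, Pi.add_apply, h2, h3, mul_add]
  map_smul' c f := by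
    apply Lp.ext
    filter_upwards [coeFn_modulationFun χ (c • f), coeFn_modulationFun χ f,
      Lp.coeFn_smul c f, Lp.coeFn_smul c (modulationFun χ f)] with y h1 h2 h3 h4
    simp only [RingHom.id_apply]
    rw [h1, h4, h3, Pi.smul_apply, Pi.smul_apply, h2, smul_eq_mul, smul_eq_mul]
    ring
  left_inv f := by rw [modulationFun_mul, inv_mul_cancel, modulationFun_one]
  right_inv f := by rw [modulationFun_mul, mul_inv_cancel, modulationFun_one]
  norm_map' f := by
    have h : ∀ᵐ y ∂Measure.haar, ‖modulationFun χ f y‖ = ‖f y‖ := by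
      filter_upwards [coeFn_modulationFun χ f] with y h1
      rw [h1, norm_mul, Circle.norm_coe, one_mul]
    exact le_antisymm (Lp.norm_le_norm_of_ae_le (h.mono fun y hy => hy.le))
      (Lp.norm_le_norm_of_ae_le (h.mono fun y hy => hy.ge))

theorem coeFn_scalar (z : Circle) (f : L2 A) :
    scalar z f =ᵐ[Measure.haar] fun y => (z : ℂ) * f y :=
  Lp.coeFn_smul (z : ℂ) f

theorem coeFn_translation (x : A) (f : L2 A) :
    translation x f =ᵐ[Measure.haar] fun y => f (x⁻¹ * y) :=
  Lp.coeFn_compMeasurePreserving f (measurePreserving_mul_left Measure.haar x⁻¹)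

theorem coeFn_modulation (χ : PontryaginDual A) (f : L2 A) :
    modulation χ f =ᵐ[Measure.haar] fun y => (χ y : ℂ) * f y :=
  coeFn_modulationFun χ f

/-- The unitary operator `z T_x M_χ`. -/
def operator (z : Circle) (x : A) (χ : PontryaginDual A) : L2 A ≃ₗᵢ[ℂ] L2 A :=
  scalar z * translation x * modulation χ

theorem coeFn_operator (z : Circle) (x : A) (χ : PontryaginDual A) (f : L2 A) :
    operator z x χ f =ᵐ[Measure.haar] fun y => (z : ℂ) * ((χ (x⁻¹ * y) : ℂ) * f (x⁻¹ * y)) := by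
  have hq := (measurePreserving_mul_left (Measure.haar : Measure A) x⁻¹).quasiMeasurePreserving
  filter_upwards [coeFn_scalar z (translation x (modulation χ f)),
    coeFn_translation x (modulation χ f), hq.ae (coeFn_modulation χ f)] with y h1 h2 h3
  change scalar z (translation x (modulation χ f)) y = _
  rw [h1, h2, h3]

theorem operator_mul (z z' : Circle) (x x' : A) (χ χ' : PontryaginDual A) :
    operator z x χ * operator z' x' χ' = operator (z * z' * χ x') (x * x') (χ * χ') := by
  ext1 f
  apply Lp.ext
  have hq := (measurePreserving_mul_left (Measure.haar : Measure A) x⁻¹).quasiMeasurePreserving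
  filter_upwards [coeFn_operator z x χ (operator z' x' χ' f), hq.ae (coeFn_operator z' x' χ' f),
    coeFn_operator (z * z' * χ x') (x * x') (χ * χ') f] with y h1 h2 h3
  change operator z x χ (operator z' x' χ' f) y = _
  have hy : x⁻¹ * y = x' * ((x * x')⁻¹ * y) := by
    rw [mul_inv_rev, mul_assoc, mul_inv_cancel_left]
  have hy' : x'⁻¹ * (x⁻¹ * y) = (x * x')⁻¹ * y := by rw [mul_inv_rev, mul_assoc]
  have hmul : (χ * χ') ((x * x')⁻¹ * y) = χ ((x * x')⁻¹ * y) * χ' ((x * x')⁻¹ * y) := rfl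
  have hχ : χ (x⁻¹ * y) = χ x' * χ ((x * x')⁻¹ * y) := by rw [hy, map_mul]
  rw [h1, h2, h3, hy', hmul, hχ]
  simp only [Circle.coe_mul]
  ring

theorem operator_one : operator (1 : Circle) (1 : A) 1 = 1 := by
  ext1 f
  apply Lp.ext
  filter_upwards [coeFn_operator (1 : Circle) (1 : A) 1 f] with y h
  rw [h]
  simp

/-- The strong operator topology: `U ↦ U f` is continuous for every `f`, and the topology is the
coarsest with this property. -/
instance strongOperatorTopology : TopologicalSpace (L2 A ≃ₗᵢ[ℂ] L2 A) :=
  TopologicalSpace.induced (fun U (f : L2 A) => U f) inferInstance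

variable (A)

/-- The standard Heisenberg group associated to `A`: the group of all unitary operators
`z T_x M_χ` on `L²(A)`, with `z ∈ U(1)`, `x ∈ A` and `χ` in the dual of `A`. -/
def standardGroup : Subgroup (L2 A ≃ₗᵢ[ℂ] L2 A) where
  carrier := {U | ∃ (z : Circle) (x : A) (χ : PontryaginDual A), U = operator z x χ}
  mul_mem' := by
    rintro _ _ ⟨z, x, χ, rfl⟩ ⟨z', x', χ', rfl⟩
    exact ⟨_, _, _, operator_mul z z' x x' χ χ'⟩
  one_mem' := ⟨1, 1, 1, operator_one.symm⟩
  inv_mem' := by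
    rintro _ ⟨z, x, χ, rfl⟩
    refine ⟨z⁻¹ * χ x, x⁻¹, χ⁻¹, inv_eq_of_mul_eq_one_right ?_⟩
    rw [operator_mul, ← operator_one]
    simp

variable {A}

/-- The element `z T_x M_χ` of the standard Heisenberg group. -/
def element (z : Circle) (x : A) (χ : PontryaginDual A) : standardGroup A :=
  ⟨operator z x χ, z, x, χ, rfl⟩

end

end Heisenberg

/-! The exponential map covers a neighbourhood of `1` in `K` by a vector space `V`. If `e` does not
vanish on `V`, two vectors span a hyperbolic plane `ℝ × ℝ`; if it does, the image of `V` is compact,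
the logarithms of the characters `e (·, k)` of `V` form a lattice, and a dual vector yields a
hyperbolic plane `ℤ × U(1)`. Passing to the orthogonal complement lowers the dimension of `V`, until
`K` is finite and splits into planes `ℤ/n × ℤ/n`. The product of all these planes is `A × Â`.

Homomorphisms from `ℝ`, `ℤ`, `U(1)` and `ℤ/n` with commuting lifts lift to a central extension `G`
of `K` by `U(1)`, so `A` and `Â` map to `G`. Both `H(A)` and `G` are then `U(1) × A × Â` with the
same multiplication. If a family of operators in `H(A)` converges strongly, so do its commutators
with fixed operators, which determine the phase space parameters; hence the topology of `H(A)` is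
the product topology. -/

section ExponentialMap

open Filter Topology Set Asymptotics

variable {V G : Type*} [NormedAddCommGroup V] [NormedSpace ℝ V] [Group G] [TopologicalSpace G]
  [ChartedSpace V G]

variable (V G) in
/-- The multiplication of a Lie group, read in the preferred chart at the identity. -/
noncomputable def chartMul (p : V × V) : V :=
  extChartAt 𝓘(ℝ, V) (1 : G)
    ((extChartAt 𝓘(ℝ, V) (1 : G)).symm p.1 * (extChartAt 𝓘(ℝ, V) (1 : G)).symm p.2)

theorem chartMul_extChartAt_one_right :
    ∀ᶠ x in 𝓝 (extChartAt 𝓘(ℝ, V) (1 : G) 1),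
      chartMul V G (x, extChartAt 𝓘(ℝ, V) (1 : G) 1) = x := by
  filter_upwards [extChartAt_target_mem_nhds (I := 𝓘(ℝ, V)) (1 : G)] with x hx
  simp only [chartMul, extChartAt_to_inv, mul_one, PartialEquiv.right_inv _ hx]

theorem chartMul_extChartAt_one_left :
    ∀ᶠ x in 𝓝 (extChartAt 𝓘(ℝ, V) (1 : G) 1),
      chartMul V G (extChartAt 𝓘(ℝ, V) (1 : G) 1, x) = x := by
  filter_upwards [extChartAt_target_mem_nhds (I := 𝓘(ℝ, V)) (1 : G)] with x hx
  simp only [chartMul, extChartAt_to_inv, one_mul, PartialEquiv.right_inv _ hx]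

theorem extChartAt_mul_eventually_eq_chartMul :
    ∀ᶠ p : G × G in 𝓝 1, extChartAt 𝓘(ℝ, V) (1 : G) (p.1 * p.2) =
      chartMul V G (extChartAt 𝓘(ℝ, V) (1 : G) p.1, extChartAt 𝓘(ℝ, V) (1 : G) p.2) := by
  have hs := extChartAt_source_mem_nhds (I := 𝓘(ℝ, V)) (1 : G)
  filter_upwards [continuousAt_fst.preimage_mem_nhds hs, continuousAt_snd.preimage_mem_nhds hs]
    with p hfst hsnd
  rw [mem_preimage] at hfst hsnd
  simp only [chartMul, PartialEquiv.left_inv _ hfst, PartialEquiv.left_inv _ hsnd]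

variable [LieGroup 𝓘(ℝ, V) ∞ G]

theorem contDiffAt_chartMul :
    ContDiffAt ℝ ∞ (chartMul V G)
      (extChartAt 𝓘(ℝ, V) (1 : G) 1, extChartAt 𝓘(ℝ, V) (1 : G) 1) := by
  have : IsManifold 𝓘(ℝ, V) ∞ G := inferInstance
  set φ := extChartAt 𝓘(ℝ, V) (1 : G) with hφ
  have hsymm : ContMDiffAt 𝓘(ℝ, V) 𝓘(ℝ, V) ∞ φ.symm (φ 1) :=
    (contMDiffOn_extChartAt_symm (1 : G)).contMDiffAt (extChartAt_target_mem_nhds (1 : G))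
  have hfst : ContMDiffAt 𝓘(ℝ, V × V) 𝓘(ℝ, V) ∞ (fun p : V × V => φ.symm p.1) (φ 1, φ 1) :=
    ContMDiffAt.comp (φ 1, φ 1) (g := φ.symm) hsymm contDiff_fst.contMDiff.contMDiffAt
  have hsnd : ContMDiffAt 𝓘(ℝ, V × V) 𝓘(ℝ, V) ∞ (fun p : V × V => φ.symm p.2) (φ 1, φ 1) :=
    ContMDiffAt.comp (φ 1, φ 1) (g := φ.symm) hsymm contDiff_snd.contMDiff.contMDiffAt
  have hchart : ContMDiffAt 𝓘(ℝ, V) 𝓘(ℝ, V) ∞ φ (φ.symm (φ 1) * φ.symm (φ 1)) := by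
    simp only [hφ, extChartAt_to_inv, mul_one]
    exact contMDiffAt_extChartAt
  exact contMDiffAt_iff_contDiffAt.1 (ContMDiffAt.comp (φ 1, φ 1) hchart (hfst.mul hsnd))

theorem hasStrictFDerivAt_chartMul :
    HasStrictFDerivAt (chartMul V G)
      (ContinuousLinearMap.fst ℝ V V + ContinuousLinearMap.snd ℝ V V)
      (extChartAt 𝓘(ℝ, V) (1 : G) 1, extChartAt 𝓘(ℝ, V) (1 : G) 1) := by
  set c := extChartAt 𝓘(ℝ, V) (1 : G) 1
  have hstrict := (contDiffAt_chartMul (V := V) (G := G)).hasStrictFDerivAt (by simp)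
  have hleft := ((hasFDerivAt_id c).congr_of_eventuallyEq
    chartMul_extChartAt_one_right).unique
      (HasFDerivAt.comp (f := fun x => (x, c)) c hstrict.hasFDerivAt (hasFDerivAt_prodMk_left c c))
  have hright := ((hasFDerivAt_id c).congr_of_eventuallyEq
    chartMul_extChartAt_one_left).unique
      (HasFDerivAt.comp (f := fun x => (c, x)) c hstrict.hasFDerivAt (hasFDerivAt_prodMk_right c c))
  refine hstrict.congr_fderiv ?_
  ext x
  · simpa using (DFunLike.congr_fun hleft x).symm
  · simpa using (DFunLike.congr_fun hright x).symm

theorem hasFDerivAt_extChartAt_mul {X : Type*} [NormedAddCommGroup X] [NormedSpace ℝ X]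
    {f g : X → G} {x : X} {f' g' : X →L[ℝ] V} (hfx : f x = 1) (hgx : g x = 1)
    (hf : ContinuousAt f x) (hg : ContinuousAt g x)
    (hf' : HasFDerivAt (fun t => extChartAt 𝓘(ℝ, V) (1 : G) (f t)) f' x)
    (hg' : HasFDerivAt (fun t => extChartAt 𝓘(ℝ, V) (1 : G) (g t)) g' x) :
    HasFDerivAt (fun t => extChartAt 𝓘(ℝ, V) (1 : G) (f t * g t)) (f' + g') x := by
  have hμ := (hasStrictFDerivAt_chartMul (V := V) (G := G)).hasFDerivAt
  have hc : (extChartAt 𝓘(ℝ, V) (1 : G) 1, extChartAt 𝓘(ℝ, V) (1 : G) 1) =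
      (extChartAt 𝓘(ℝ, V) (1 : G) (f x), extChartAt 𝓘(ℝ, V) (1 : G) (g x)) := by rw [hfx, hgx]
  rw [hc] at hμ
  have hfg : Tendsto (fun t => (f t, g t)) (𝓝 x) (𝓝 1) := by
    simpa only [hfx, hgx, Prod.mk_one_one, nhds_prod_eq] using hf.prodMk_nhds hg
  have h := HasFDerivAt.comp x hμ (hf'.prodMk hg')
  have heq : (fun t => extChartAt 𝓘(ℝ, V) (1 : G) (f t * g t)) =ᶠ[𝓝 x] chartMul V G ∘
      fun t => (extChartAt 𝓘(ℝ, V) (1 : G) (f t), extChartAt 𝓘(ℝ, V) (1 : G) (g t)) :=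
    hfg.eventually (extChartAt_mul_eventually_eq_chartMul (V := V))
  exact (h.congr_of_eventuallyEq heq).congr_fderiv (ContinuousLinearMap.ext fun t => by simp)

/-- With `μ` the multiplication and `F` the homomorphism, both read in the chart,
`F v - F w = μ (F (v - w), F w) - μ (F 0, F w)`, and `μ` is strictly differentiable. -/
theorem isLittleO_extChartAt_hom_sub {X : Type*} [AddGroup X] [TopologicalSpace X]
    [IsTopologicalAddGroup X] (E : Multiplicative X →ₜ* G) {F : X → V}
    (hF : ∀ v, F v = extChartAt 𝓘(ℝ, V) (1 : G) (E (.ofAdd v))) :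
    (fun p : X × X => F p.1 - F p.2 - (F (p.1 - p.2) - F 0)) =o[𝓝 (0, 0)]
      fun p => F (p.1 - p.2) - F 0 := by
  have hF0 : F 0 = extChartAt 𝓘(ℝ, V) (1 : G) 1 := by rw [hF, ofAdd_zero, map_one]
  have hE : Tendsto (fun v : X => E (.ofAdd v)) (𝓝 0) (𝓝 1) :=
    ((map_continuous E).comp continuous_ofAdd).tendsto' _ _ (map_one E)
  have hFt : Tendsto F (𝓝 0) (𝓝 (F 0)) := by
    rw [hF0, funext hF]
    exact (continuousAt_extChartAt (I := 𝓘(ℝ, V)) (1 : G)).tendsto.comp hE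
  have hsub : Tendsto (fun p : X × X => p.1 - p.2) (𝓝 (0, 0)) (𝓝 0) :=
    Continuous.tendsto' (by fun_prop) _ _ (sub_zero 0)
  have hsnd : Tendsto (fun p : X × X => p.2) (𝓝 (0, 0)) (𝓝 0) := continuousAt_snd
  have hpair : Tendsto (fun p : X × X => ((F (p.1 - p.2), F p.2), (F 0, F p.2))) (𝓝 (0, 0))
      (𝓝 ((F 0, F 0), (F 0, F 0))) :=
    ((hFt.comp hsub).prodMk_nhds (hFt.comp hsnd)).prodMk_nhds
      (tendsto_const_nhds.prodMk_nhds (hFt.comp hsnd))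
  have hμ := hasStrictFDerivAt_chartMul (V := V) (G := G)
  rw [← hF0] at hμ
  refine ((hμ.isLittleO.comp_tendsto hpair).congr' ?_ .rfl).trans_isBigO
    (.of_bound 1 (.of_forall fun p => by simp [Prod.norm_def]))
  filter_upwards [((hE.comp hsub).prodMk_nhds (hE.comp hsnd)).eventually
    (extChartAt_mul_eventually_eq_chartMul (V := V)),
    (hFt.comp hsnd).eventually (hF0 ▸ chartMul_extChartAt_one_left (G := G))] with p hleft hright
  simp only [Function.comp_apply, ← hF, ← map_mul, ← ofAdd_add, sub_add_cancel] at hleft hright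
  simp [← hleft, hright]

theorem hasStrictFDerivAt_extChartAt_hom {X : Type*} [NormedAddCommGroup X] [NormedSpace ℝ X]
    (E : Multiplicative X →ₜ* G) {L : X →L[ℝ] V}
    (hE : HasFDerivAt (fun v => extChartAt 𝓘(ℝ, V) (1 : G) (E (.ofAdd v))) L 0) :
    HasStrictFDerivAt (fun v => extChartAt 𝓘(ℝ, V) (1 : G) (E (.ofAdd v))) L 0 := by
  set F : X → V := fun v => extChartAt 𝓘(ℝ, V) (1 : G) (E (.ofAdd v))
  have hsub : Tendsto (fun p : X × X => p.1 - p.2) (𝓝 (0, 0)) (𝓝 0) :=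
    Continuous.tendsto' (by fun_prop) _ _ (sub_zero 0)
  have hlin : (fun p : X × X => F (p.1 - p.2) - F 0 - L (p.1 - p.2)) =o[𝓝 (0, 0)]
      fun p => p.1 - p.2 := by
    simpa only [sub_zero, Function.comp_def] using hE.isLittleO.comp_tendsto hsub
  have hbig : (fun p : X × X => F (p.1 - p.2) - F 0) =O[𝓝 (0, 0)] fun p => p.1 - p.2 := by
    simpa only [sub_zero, Function.comp_def] using hE.isBigO_sub.comp_tendsto hsub
  have hμ := isLittleO_extChartAt_hom_sub E (F := F) fun _ => rfl
  refine .of_isLittleO (((hμ.trans_isBigO hbig).add hlin).congr_left fun p => ?_)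
  abel

theorem isOpenMap_of_hasFDerivAt_extChartAt_hom [CompleteSpace V] {X : Type*}
    [NormedAddCommGroup X] [NormedSpace ℝ X] [CompleteSpace X] (E : Multiplicative X →ₜ* G)
    {L : X →L[ℝ] V} (hE : HasFDerivAt (fun v => extChartAt 𝓘(ℝ, V) (1 : G) (E (.ofAdd v))) L 0)
    (hL : L.range = ⊤) : IsOpenMap E := by
  have : IsTopologicalGroup G := topologicalGroup_of_lieGroup 𝓘(ℝ, V) ∞
  have : IsTopologicalGroup (Multiplicative X) := inferInstance
  rw [IsTopologicalGroup.isOpenMap_iff_nhds_one]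
  set φ := extChartAt 𝓘(ℝ, V) (1 : G)
  have hmap := (hasStrictFDerivAt_extChartAt_hom E hE).map_nhds_eq_of_surj hL
  have hEt : Tendsto (fun v : X => E (.ofAdd v)) (𝓝 0) (𝓝 1) :=
    ((map_continuous E).comp continuous_ofAdd).tendsto' _ _ (by simp)
  have hleft : ∀ᶠ v in 𝓝 (0 : X), φ.symm (φ (E (.ofAdd v))) = E (.ofAdd v) :=
    (hEt.eventually (extChartAt_source_mem_nhds (I := 𝓘(ℝ, V)) (1 : G))).mono
      fun v hv => φ.left_inv hv
  rw [ofAdd_zero, map_one] at hmap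
  have hchart : Tendsto φ (𝓝 1) (𝓝 (φ 1)) := continuousAt_extChartAt (1 : G)
  have hright : map φ.symm (map φ (𝓝 1)) = 𝓝 1 := by
    rw [map_map]
    refine (map_congr ?_).trans map_id
    filter_upwards [extChartAt_source_mem_nhds (I := 𝓘(ℝ, V)) (1 : G)] with g hg
    exact φ.left_inv hg
  calc 𝓝 1 = map φ.symm (map φ (𝓝 1)) := hright.symm
    _ ≤ map φ.symm (𝓝 (φ 1)) := map_mono hchart
    _ = map (fun v : X => E (.ofAdd v)) (𝓝 0) := by
      rw [← hmap, map_map]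
      exact map_congr hleft
    _ = map E (𝓝 1) := rfl

end ExponentialMap

section OneParameterSubgroup

open Filter Topology Set

variable {V G : Type*} [NormedAddCommGroup V] [NormedSpace ℝ V] [Group G] [TopologicalSpace G]
  [ChartedSpace V G]

theorem mulInvariantVectorField_one (v : GroupLieAlgebra 𝓘(ℝ, V) G) :
    mulInvariantVectorField v (1 : G) = v := by
  have h : ((1 : G) * ·) = id := funext one_mul
  simp only [mulInvariantVectorField]
  rw [h, mfderiv_id]
  rfl

variable [LieGroup 𝓘(ℝ, V) ∞ G]

theorem mfderiv_mul_left_mulInvariantVectorField (v : GroupLieAlgebra 𝓘(ℝ, V) G) (g h : G) :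
    mfderiv 𝓘(ℝ, V) 𝓘(ℝ, V) (g * ·) h (mulInvariantVectorField v h) =
      mulInvariantVectorField v (g * h) := by
  have hd : ∀ a b : G, MDifferentiableAt 𝓘(ℝ, V) 𝓘(ℝ, V) (a * ·) b := fun a b =>
    (contMDiff_mul_left (n := ∞)).contMDiffAt.mdifferentiableAt (by simp)
  have hcomp : (g * h * ·) = (g * ·) ∘ (h * ·) := funext fun x => mul_assoc g h x
  simp only [mulInvariantVectorField]
  rw [hcomp, mfderiv_comp (I' := 𝓘(ℝ, V)) (1 : G) (hd g _) (hd h 1)]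
  congr 2
  simp

theorem isMIntegralCurveOn_mul_left {v : GroupLieAlgebra 𝓘(ℝ, V) G} {γ : ℝ → G} {s : Set ℝ}
    (g : G) (hγ : IsMIntegralCurveOn γ (mulInvariantVectorField (I := 𝓘(ℝ, V)) v) s) :
    IsMIntegralCurveOn (fun t => g * γ t) (mulInvariantVectorField (I := 𝓘(ℝ, V)) v) s := by
  intro t ht
  have hd : MDifferentiableAt 𝓘(ℝ, V) 𝓘(ℝ, V) (g * ·) (γ t) :=
    (contMDiff_mul_left (n := ∞)).contMDiffAt.mdifferentiableAt (by simp)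
  refine (hd.hasMFDerivAt.comp_hasMFDerivWithinAt t (hγ t ht)).congr_mfderiv ?_
  rw [← mfderiv_mul_left_mulInvariantVectorField]
  exact ContinuousLinearMap.ext_ring (map_smul (mfderiv 𝓘(ℝ, V) 𝓘(ℝ, V) (g * ·) (γ t)) (1 : ℝ) _)

theorem contMDiff_one_mulInvariantVectorField (v : GroupLieAlgebra 𝓘(ℝ, V) G) :
    ContMDiff 𝓘(ℝ, V) 𝓘(ℝ, V).tangent 1
      fun g : G => (⟨g, mulInvariantVectorField v g⟩ : TangentBundle 𝓘(ℝ, V) G) := by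
  have : LieGroup 𝓘(ℝ, V) (minSmoothness ℝ 3) G := .of_le (n := ∞) (by
    simp only [minSmoothness_of_isRCLikeNormedField]; exact WithTop.coe_le_coe.2 le_top)
  refine (contMDiff_mulInvariantVectorField v).of_le ?_
  simp only [minSmoothness_of_isRCLikeNormedField]
  norm_num

variable [T2Space G]

theorem map_add_of_isMIntegralCurve {v : GroupLieAlgebra 𝓘(ℝ, V) G} {γ : ℝ → G}
    (hγ : IsMIntegralCurve γ (mulInvariantVectorField (I := 𝓘(ℝ, V)) v)) (h0 : γ 0 = 1)
    (s t : ℝ) : γ (s + t) = γ s * γ t := by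
  have : IsManifold 𝓘(ℝ, V) 1 G := .of_le (n := ∞) (by exact_mod_cast le_top)
  have hmul : IsMIntegralCurve (γ s * γ ·) (mulInvariantVectorField (I := 𝓘(ℝ, V)) v) := by
    rw [isMIntegralCurve_iff_isMIntegralCurveOn] at hγ ⊢
    exact isMIntegralCurveOn_mul_left (γ s) hγ
  have heq := isMIntegralCurve_Ioo_eq_of_contMDiff_boundaryless (t₀ := 0)
    (contMDiff_one_mulInvariantVectorField v) hmul (hγ.comp_add s) (by simp [h0])
  simpa [add_comm] using (congrFun heq t).symm

variable [CompleteSpace V]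

theorem exists_isMIntegralCurve_mulInvariantVectorField (v : GroupLieAlgebra 𝓘(ℝ, V) G) :
    ∃ γ : ℝ → G, γ 0 = 1 ∧ IsMIntegralCurve γ (mulInvariantVectorField (I := 𝓘(ℝ, V)) v) := by
  have hv := contMDiff_one_mulInvariantVectorField v
  have : IsManifold 𝓘(ℝ, V) 1 G := .of_le (n := ∞) (by exact_mod_cast le_top)
  obtain ⟨γ, hγ, hcurve⟩ := exists_isMIntegralCurveAt_of_contMDiffAt_boundaryless (t₀ := 0)
    (hv.contMDiffAt (x := (1 : G)))
  obtain ⟨ε, hε, hcurve⟩ := isMIntegralCurveAt_iff'.1 hcurve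
  rw [Real.ball_eq_Ioo, zero_sub, zero_add] at hcurve
  exact exists_isMIntegralCurve_of_isMIntegralCurveOn hv hε
    (fun x => ⟨fun t => x * γ t, by simp [hγ], isMIntegralCurveOn_mul_left x hcurve⟩) 1

theorem exists_oneParameterSubgroup (v : V) :
    ∃ γ : Multiplicative ℝ →ₜ* G,
      HasDerivAt (fun t => extChartAt 𝓘(ℝ, V) (1 : G) (γ (.ofAdd t))) v 0 := by
  obtain ⟨γ, h0, hγ⟩ := exists_isMIntegralCurve_mulInvariantVectorField (G := G) (V := V) v
  have hv : ∀ g : G, g = 1 → mulInvariantVectorField (I := 𝓘(ℝ, V)) (G := G) v g = v := by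
    rintro _ rfl
    exact mulInvariantVectorField_one v
  refine ⟨⟨MonoidHom.mk' (fun t => γ t.toAdd) fun s t => map_add_of_isMIntegralCurve hγ h0 _ _,
    (continuous_iff_continuousAt.2 fun t => (hγ t).continuousAt).comp continuous_toAdd⟩, ?_⟩
  have hder : HasFDerivWithinAt (writtenInExtChartAt 𝓘(ℝ, ℝ) 𝓘(ℝ, V) 0 γ)
      ((1 : ℝ →L[ℝ] ℝ).smulRight v) (range 𝓘(ℝ, ℝ)) (extChartAt 𝓘(ℝ, ℝ) (0 : ℝ) 0) := by
    rw [← hv _ h0]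
    exact (hγ 0).2
  simp only [writtenInExtChartAt, h0, extChartAt_model_space_eq_id, modelWithCornersSelf_coe,
    range_id, hasFDerivWithinAt_univ, PartialEquiv.refl_coe, PartialEquiv.refl_symm, id_eq,
    Function.comp_id] at hder
  have hγ' := hder.hasDerivAt
  rwa [ContinuousLinearMap.smulRight_apply, one_apply_eq_self, one_smul] at hγ'

end OneParameterSubgroup

section Exponential

open Topology

theorem exists_hom_hasFDerivAt_id {V K : Type*} [NormedAddCommGroup V] [NormedSpace ℝ V]
    [FiniteDimensional ℝ V] [CommGroup K] [TopologicalSpace K] [T2Space K]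
    [ChartedSpace V K] [LieGroup 𝓘(ℝ, V) ∞ K] :
    ∃ E : Multiplicative V →ₜ* K,
      HasFDerivAt (fun v => extChartAt 𝓘(ℝ, V) (1 : K) (E (.ofAdd v)))
        (ContinuousLinearMap.id ℝ V) 0 := by
  have : IsTopologicalGroup K := topologicalGroup_of_lieGroup 𝓘(ℝ, V) ∞
  have : CompleteSpace V := FiniteDimensional.complete ℝ V
  let b := Module.finBasis ℝ V
  choose γ hγ using fun i => exists_oneParameterSubgroup (G := K) (b i)
  let coord : Fin _ → V →L[ℝ] ℝ := fun i => (b.coord i).toContinuousLinearMap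
  let E : Fin _ → Multiplicative V →ₜ* K := fun i =>
    (γ i).comp ⟨(coord i : V →+ ℝ).toMultiplicative, (coord i).continuous⟩
  have hE : ∀ i, HasFDerivAt (fun v => extChartAt 𝓘(ℝ, V) (1 : K) (E i (.ofAdd v)))
      ((coord i).smulRight (b i)) 0 := fun i => by
    have h := (map_zero (coord i) ▸ hγ i : HasDerivAt _ _ (coord i 0)).hasFDerivAt.comp
      (0 : V) (coord i).hasFDerivAt
    exact h.congr_fderiv (ContinuousLinearMap.ext fun v => by simp)
  have hprod : ∀ s : Finset (Fin (Module.finrank ℝ V)),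
      HasFDerivAt (fun v => extChartAt 𝓘(ℝ, V) (1 : K) ((∏ i ∈ s, E i) (.ofAdd v)))
        (∑ i ∈ s, (coord i).smulRight (b i)) 0 := by
    intro s
    induction s using Finset.induction_on with
    | empty => exact hasFDerivAt_const (extChartAt 𝓘(ℝ, V) (1 : K) 1) (0 : V)
    | insert i s hi ih =>
      simp only [Finset.prod_insert hi, Finset.sum_insert hi, ContinuousMonoidHom.mul_apply]
      exact hasFDerivAt_extChartAt_mul (f := fun v => E i (.ofAdd v))
        (g := fun v => (∏ i ∈ s, E i) (.ofAdd v)) (map_one (E i)) (map_one (∏ i ∈ s, E i))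
        (map_continuous (E i)).continuousAt (map_continuous (∏ i ∈ s, E i)).continuousAt (hE i) ih
  refine ⟨∏ i, E i, (hprod Finset.univ).congr_fderiv (ContinuousLinearMap.ext fun v => ?_)⟩
  simp [coord, b.sum_repr]

namespace IsLieGroup

variable {K : Type*} [TopologicalSpace K]

theorem isTopologicalGroup [Group K] (hK : IsLieGroup K) : IsTopologicalGroup K :=
  let ⟨n, _, _⟩ := hK.exists_smooth_structure
  topologicalGroup_of_lieGroup (𝓡 n) ∞

theorem exists_exponential [CommGroup K] (hK : IsLieGroup K) :
    ∃ (n : ℕ) (E : Multiplicative (EuclideanSpace ℝ (Fin n)) →ₜ* K), IsOpenMap E := by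
  have := hK.t2
  obtain ⟨n, _, _⟩ := hK.exists_smooth_structure
  obtain ⟨E, hE⟩ := exists_hom_hasFDerivAt_id (V := EuclideanSpace ℝ (Fin n)) (K := K)
  exact ⟨n, E, isOpenMap_of_hasFDerivAt_extChartAt_hom E hE (by simp)⟩

end IsLieGroup

end Exponential

universe u v

section ProductEquiv

variable {A B C D : Type*} [CommGroup A] [TopologicalSpace A] [CommGroup B] [TopologicalSpace B]
  [CommGroup C] [TopologicalSpace C] [CommGroup D] [TopologicalSpace D]

/-- The product of two isomorphisms of topological groups. -/
def prodCongrContinuous (f : A ≃ₜ* C) (g : B ≃ₜ* D) : A × B ≃ₜ* C × D :=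
  .mk' (f.toHomeomorph.prodCongr g.toHomeomorph) fun p q =>
    Prod.ext (map_mul f p.1 q.1) (map_mul g p.2 q.2)

variable (A B C D) in
/-- The interchange of the two middle factors as an isomorphism of topological groups. -/
def prodProdProdCommContinuous : (A × B) × C × D ≃ₜ* (A × C) × B × D :=
  .mk' (Homeomorph.prodProdProdComm A B C D) fun _ _ => rfl

variable (A B) in
/-- The dual of a product is the product of the duals. -/
noncomputable def pontryaginDualProd :
    (PontryaginDual A × PontryaginDual B) ≃ₜ* PontryaginDual (A × B) where
  toFun p := PontryaginDual.map (ContinuousMonoidHom.fst A B) p.1 *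
    PontryaginDual.map (ContinuousMonoidHom.snd A B) p.2
  invFun χ := (PontryaginDual.map (ContinuousMonoidHom.inl A B) χ,
    PontryaginDual.map (ContinuousMonoidHom.inr A B) χ)
  left_inv p := by
    refine Prod.ext (PontryaginDual.ext fun a => ?_) (PontryaginDual.ext fun b => ?_)
    · change p.1 a * p.2 1 = p.1 a
      rw [map_one, mul_one]
    · change p.1 1 * p.2 b = p.2 b
      rw [map_one, one_mul]
  right_inv χ := by
    refine PontryaginDual.ext fun a => ?_
    change χ (a.1, 1) * χ (1, a.2) = χ a
    rw [← map_mul, Prod.mk_mul_mk, mul_one, one_mul]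
  map_mul' p q := by
    simp only [Prod.fst_mul, Prod.snd_mul, map_mul]
    exact mul_mul_mul_comm _ _ _ _
  continuous_toFun :=
    ((map_continuous _).comp continuous_fst).mul ((map_continuous _).comp continuous_snd)
  continuous_invFun := (map_continuous _).prodMk (map_continuous _)

theorem pontryaginDualProd_symm_fst_mul_snd (χ : PontryaginDual (A × B)) (a : A) (b : B) :
    ((pontryaginDualProd A B).symm χ).1 a * ((pontryaginDualProd A B).symm χ).2 b = χ (a, b) :=
  DFunLike.congr_fun ((pontryaginDualProd A B).apply_symm_apply χ) (a, b)

end ProductEquiv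

section Retraction

variable {K L : Type*} [CommGroup K] [TopologicalSpace K] [IsTopologicalGroup K] [CommGroup L]
  [TopologicalSpace L] {ι : L →ₜ* K} {P : K →ₜ* L}

/-- The projection onto the kernel of `P` along the image of a section `ι` of `P`. -/
def kerRetraction (h : Function.LeftInverse P ι) : K →ₜ* P.toMonoidHom.ker where
  toFun k := ⟨k * (ι (P k))⁻¹,
    show P (k * (ι (P k))⁻¹) = 1 by rw [map_mul, map_inv, h, mul_inv_cancel]⟩
  map_one' := Subtype.ext (by simp)
  map_mul' k l := Subtype.ext (by
    simp only [map_mul, mul_inv, Subgroup.coe_mul]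
    exact mul_mul_mul_comm _ _ _ _)
  continuous_toFun := Continuous.subtype_mk (by fun_prop) _

variable (h : Function.LeftInverse P ι)

theorem coe_kerRetraction (k : K) : (kerRetraction h k : K) = k * (ι (P k))⁻¹ := rfl

theorem kerRetraction_coe (k : P.toMonoidHom.ker) : kerRetraction h k = k :=
  Subtype.ext (by rw [coe_kerRetraction, show P k = 1 from k.2, map_one, inv_one, mul_one])

theorem kerRetraction_section (l : L) : kerRetraction h (ι l) = 1 :=
  Subtype.ext (by rw [coe_kerRetraction, h, mul_inv_cancel, Subgroup.coe_one])

/-- A section `ι` of `P` splits the group as the product of the image of `ι` and the kernel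
of `P`. -/
def prodKerEquiv : L × P.toMonoidHom.ker ≃ₜ* K where
  toFun p := ι p.1 * p.2
  invFun k := (P k, kerRetraction h k)
  left_inv := by
    rintro ⟨l, k⟩
    have hl : P (ι l * k) = l := by rw [map_mul, h, show P k = 1 from k.2, mul_one]
    refine Prod.ext hl ?_
    change kerRetraction h (ι l * k) = k
    rw [map_mul, kerRetraction_section, kerRetraction_coe, one_mul]
  right_inv k := by
    change ι (P k) * (k * (ι (P k))⁻¹) = k
    rw [mul_comm k, mul_inv_cancel_left]
  map_mul' p q := by
    simp only [Prod.fst_mul, Prod.snd_mul, map_mul, Subgroup.coe_mul]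
    exact mul_mul_mul_comm _ _ _ _
  continuous_toFun := by fun_prop
  continuous_invFun := (map_continuous P).prodMk (map_continuous _)

theorem surjective_kerRetraction : Function.Surjective (kerRetraction h) := fun k =>
  ⟨k, kerRetraction_coe h k⟩

theorem isOpenMap_kerRetraction : IsOpenMap (kerRetraction h) :=
  isOpenMap_snd.comp (prodKerEquiv h).symm.toHomeomorph.isOpenMap

end Retraction

namespace IsAlternatingBicharacter

variable {K : Type*} [CommGroup K] {e : K → K → Circle}

/-- The homomorphism `e (·, l)`. -/
noncomputable def leftHom (he : IsAlternatingBicharacter e) (l : K) : K →* Circle :=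
  MonoidHom.mk' (fun k => e k l) fun k m => he.mul_left k m l

/-- The homomorphism `e (k, ·)`. -/
noncomputable def rightHom (he : IsAlternatingBicharacter e) (k : K) : K →* Circle :=
  MonoidHom.mk' (fun l => e k l) fun l m => he.mul_right k l m

theorem one_left (he : IsAlternatingBicharacter e) (l : K) : e 1 l = 1 := (he.leftHom l).map_one

theorem inv_left (he : IsAlternatingBicharacter e) (k l : K) : e k⁻¹ l = (e k l)⁻¹ :=
  (he.leftHom l).map_inv k

theorem inv_right (he : IsAlternatingBicharacter e) (k l : K) : e k l⁻¹ = (e k l)⁻¹ :=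
  (he.rightHom k).map_inv l

theorem pow_left (he : IsAlternatingBicharacter e) (k l : K) (n : ℕ) : e (k ^ n) l = e k l ^ n :=
  (he.leftHom l).map_pow k n

theorem pow_right (he : IsAlternatingBicharacter e) (k l : K) (n : ℕ) : e k (l ^ n) = e k l ^ n :=
  (he.rightHom k).map_pow l n

theorem zpow_left (he : IsAlternatingBicharacter e) (k l : K) (n : ℤ) : e (k ^ n) l = e k l ^ n :=
  (he.leftHom l).map_zpow k n

theorem zpow_right (he : IsAlternatingBicharacter e) (k l : K) (n : ℤ) :
    e k (l ^ n) = e k l ^ n :=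
  (he.rightHom k).map_zpow l n

theorem swap (he : IsAlternatingBicharacter e) (k l : K) : e l k = (e k l)⁻¹ := by
  have h := he.alternating (k * l)
  rw [he.mul_left, he.mul_right, he.mul_right, he.alternating, he.alternating, one_mul,
    mul_one] at h
  exact eq_inv_of_mul_eq_one_right h

theorem restrict (he : IsAlternatingBicharacter e) (H : Subgroup K) :
    IsAlternatingBicharacter fun k l : H => e k l :=
  ⟨fun k m l => he.mul_left k m l, fun k l m => he.mul_right k l m, fun k => he.alternating k⟩

end IsAlternatingBicharacter

namespace IsNondegenerateBicharacter

variable {K : Type*} [CommGroup K] [TopologicalSpace K] {e : K → K → Circle}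

/-- The isomorphism `l ↦ e (·, l)` from `K` onto its Pontryagin dual. -/
noncomputable def flat (hn : IsNondegenerateBicharacter e) : K ≃ₜ* PontryaginDual K := hn.choose

theorem flat_apply (hn : IsNondegenerateBicharacter e) (k l : K) : hn.flat l k = e k l :=
  hn.choose_spec k l

theorem apply_flat_symm (hn : IsNondegenerateBicharacter e) (k : K) (χ : PontryaginDual K) :
    e k (hn.flat.symm χ) = χ k := by
  rw [← hn.flat_apply, ContinuousMulEquiv.apply_symm_apply]

theorem eq_of_forall_apply_eq (hn : IsNondegenerateBicharacter e) {l m : K}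
    (h : ∀ k, e k l = e k m) : l = m :=
  hn.flat.injective (PontryaginDual.ext fun k => by rw [hn.flat_apply, hn.flat_apply, h])

/-- Given a retraction `r` onto a group `H`, a character `χ` of `H` is represented on `H` by the
image under `r` of the element representing `χ ∘ r` on `K`. -/
theorem of_retraction (hn : IsNondegenerateBicharacter e) (he : IsAlternatingBicharacter e)
    {H : Type*} [CommGroup H] [TopologicalSpace H] (ι : H →ₜ* K) (r : K →ₜ* H)
    (hr : Function.LeftInverse r ι) (her : ∀ k l, e (ι k) (ι (r l)) = e (ι k) l) :
    IsNondegenerateBicharacter fun k l => e (ι k) (ι l) := by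
  have her' : ∀ k l, e (ι (r k)) (ι l) = e k (ι l) := fun k l => by
    rw [he.swap, her, ← he.swap]
  refine ⟨{
    toFun := fun l => PontryaginDual.map ι (hn.flat (ι l))
    invFun := fun χ => r (hn.flat.symm (PontryaginDual.map r χ))
    left_inv := fun l => ?_
    right_inv := fun χ => PontryaginDual.ext fun k => ?_
    map_mul' := fun k l => by simp only [map_mul]
    continuous_toFun := (map_continuous _).comp ((map_continuous hn.flat).comp (map_continuous ι))
    continuous_invFun :=
      (map_continuous r).comp ((map_continuous hn.flat.symm).comp (map_continuous _)) },
    fun k l => hn.flat_apply (ι k) (ι l)⟩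
  · have hl : hn.flat.symm (PontryaginDual.map r (PontryaginDual.map ι (hn.flat (ι l)))) = ι l :=
      hn.eq_of_forall_apply_eq fun k => by
        rw [hn.apply_flat_symm, PontryaginDual.map_apply, PontryaginDual.map_apply, hn.flat_apply,
          her']
    exact (congrArg r hl).trans (hr l)
  · rw [PontryaginDual.map_apply, hn.flat_apply, her, hn.apply_flat_symm,
      PontryaginDual.map_apply, hr]

theorem comp (hn : IsNondegenerateBicharacter e) (he : IsAlternatingBicharacter e) {L : Type*}
    [CommGroup L] [TopologicalSpace L] (φ : L ≃ₜ* K) :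
    IsNondegenerateBicharacter fun k l => e (φ k) (φ l) :=
  hn.of_retraction he (φ : L →ₜ* K) (φ.symm : K →ₜ* L) φ.symm_apply_apply fun k l =>
    congrArg (e (φ k)) (φ.apply_symm_apply l)

end IsNondegenerateBicharacter

/-- The group is the product of a Euclidean space and a countable discrete group. -/
def IsEuclideanTimesDiscrete (A : Type) [CommGroup A] [TopologicalSpace A] : Prop :=
  ∃ (V : Type) (_ : NormedAddCommGroup V) (_ : NormedSpace ℝ V) (_ : FiniteDimensional ℝ V)
    (D : Type) (_ : CommGroup D) (_ : TopologicalSpace D) (_ : DiscreteTopology D)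
    (_ : Countable D), Nonempty (A ≃ₜ* Multiplicative V × D)

namespace IsEuclideanTimesDiscrete

theorem prod {A B : Type} [CommGroup A] [TopologicalSpace A] [CommGroup B] [TopologicalSpace B]
    (hA : IsEuclideanTimesDiscrete A) (hB : IsEuclideanTimesDiscrete B) :
    IsEuclideanTimesDiscrete (A × B) := by
  obtain ⟨V, _, _, _, D, _, _, _, _, ⟨f⟩⟩ := hA
  obtain ⟨W, _, _, _, D', _, _, _, _, ⟨g⟩⟩ := hB
  let vectors : Multiplicative V × Multiplicative W ≃ₜ* Multiplicative (V × W) :=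
    { (MulEquiv.prodMultiplicative V W).symm with
      continuous_toFun := continuous_id
      continuous_invFun := continuous_id }
  exact ⟨V × W, inferInstance, inferInstance, inferInstance, D × D', inferInstance,
    inferInstance, inferInstance, inferInstance,
    ⟨((prodCongrContinuous f g).trans (prodProdProdCommContinuous _ _ _ _)).trans
      (prodCongrContinuous vectors (.refl _))⟩⟩

theorem of_discreteTopology (D : Type) [CommGroup D] [TopologicalSpace D] [DiscreteTopology D]
    [Countable D] : IsEuclideanTimesDiscrete D :=
  ⟨PUnit, inferInstance, inferInstance, inferInstance, D, inferInstance, inferInstance,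
    inferInstance, inferInstance,
    ⟨{ MulEquiv.uniqueProd.symm with
       continuous_toFun := continuous_const.prodMk continuous_id
       continuous_invFun := continuous_snd }⟩⟩

theorem real : IsEuclideanTimesDiscrete (Multiplicative ℝ) :=
  ⟨ℝ, inferInstance, inferInstance, inferInstance, PUnit, inferInstance, inferInstance,
    inferInstance, inferInstance,
    ⟨{ MulEquiv.prodUnique.symm with
       continuous_toFun := continuous_id.prodMk continuous_const
       continuous_invFun := continuous_fst }⟩⟩

end IsEuclideanTimesDiscrete

/-- Homomorphisms from `A` with commuting lifts can be lifted along topological central extensions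
by the circle. -/
def HasLifts (A : Type) [CommGroup A] [TopologicalSpace A] : Prop :=
  ∀ (K : Type u) (G : Type v) [CommGroup K] [TopologicalSpace K] [Group G] [TopologicalSpace G]
    [IsTopologicalGroup G] [T2Space G]
    (S : GroupExtension Circle G K), IsTopologicalCentralExtension S → ∀ α : A →ₜ* K,
    (∀ a b g h, S.rightHom g = α a → S.rightHom h = α b → Commute g h) →
    ∃ σ : A →ₜ* G, ∀ a, S.rightHom (σ a) = α a

namespace HasLifts

variable {A B : Type} [CommGroup A] [TopologicalSpace A] [CommGroup B] [TopologicalSpace B]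

theorem prod (hA : HasLifts.{u, v} A) (hB : HasLifts.{u, v} B) : HasLifts.{u, v} (A × B) := by
  intro K G _ _ _ _ _ _ S hS α hα
  obtain ⟨σ, hσ⟩ := hA K G S hS (α.comp (ContinuousMonoidHom.inl A B))
    fun a b g h hg hh => hα _ _ g h hg hh
  obtain ⟨τ, hτ⟩ := hB K G S hS (α.comp (ContinuousMonoidHom.inr A B))
    fun a b g h hg hh => hα _ _ g h hg hh
  refine ⟨⟨MonoidHom.mk' (fun p => σ p.1 * τ p.2) fun p q => ?_, ?_⟩, fun p => ?_⟩
  · have hc : Commute (τ p.2) (σ q.1) := hα _ _ _ _ (hτ _) (hσ _)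
    rw [Prod.fst_mul, Prod.snd_mul, map_mul, map_mul]
    exact hc.symm.mul_mul_mul_comm _ _
  · exact ((map_continuous σ).comp continuous_fst).mul ((map_continuous τ).comp continuous_snd)
  · change S.rightHom (σ p.1 * τ p.2) = α p
    rw [map_mul, hσ, hτ]
    change α (p.1, 1) * α (1, p.2) = α p
    rw [← map_mul, Prod.mk_mul_mk, mul_one, one_mul]

theorem of_equiv (hA : HasLifts.{u, v} A) (f : A ≃ₜ* B) : HasLifts.{u, v} B := by
  intro K G _ _ _ _ _ _ S hS α hα
  obtain ⟨σ, hσ⟩ := hA K G S hS (α.comp (f : A →ₜ* B)) fun a b => hα (f a) (f b)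
  refine ⟨σ.comp (f.symm : B →ₜ* A), fun b => (hσ (f.symm b)).trans ?_⟩
  exact congrArg α (f.apply_symm_apply b)

end HasLifts

/-- `K` with its bicharacter is of the form `A × Â` for an elementary group `A`, and homomorphisms
from `A` and `Â` can be lifted along extensions by the circle. -/
def HasPolarization {K : Type u} [CommGroup K] [TopologicalSpace K] (e : K → K → Circle) : Prop :=
  ∃ (A : Type) (_ : CommGroup A) (_ : TopologicalSpace A), IsEuclideanTimesDiscrete A ∧
    HasLifts.{u, v} A ∧ HasLifts.{u, v} (PontryaginDual A) ∧
    ∃ φ : A × PontryaginDual A ≃ₜ* K, ∀ x x' χ χ', e (φ (x, χ)) (φ (x', χ')) = χ' x * (χ x')⁻¹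

/-- Two groups, each identified with the dual of the other by the same pairing. -/
structure DualPair (A B : Type*) [CommGroup A] [TopologicalSpace A] [CommGroup B]
    [TopologicalSpace B] where
  dual : B ≃ₜ* PontryaginDual A
  bidual : A ≃ₜ* PontryaginDual B
  bidual_apply : ∀ a b, bidual a b = dual b a

namespace DualPair

variable {A B : Type*} [CommGroup A] [TopologicalSpace A] [CommGroup B] [TopologicalSpace B]

theorem left_ext (p : DualPair A B) {a a' : A} (h : ∀ b, p.dual b a = p.dual b a') : a = a' :=
  p.bidual.injective (PontryaginDual.ext fun b => by rw [p.bidual_apply, p.bidual_apply, h])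

theorem right_ext (p : DualPair A B) {b b' : B} (h : ∀ a, p.dual b a = p.dual b' a) : b = b' :=
  p.dual.injective (PontryaginDual.ext h)

end DualPair

/-- The images of `α` and `β` are isotropic, and `e` pairs them as the dual pair `p`. -/
structure IsHyperbolicPair {K A B : Type*} [CommGroup K] [TopologicalSpace K] [CommGroup A]
    [TopologicalSpace A] [CommGroup B] [TopologicalSpace B] (e : K → K → Circle)
    (p : DualPair A B) (α : A →ₜ* K) (β : B →ₜ* K) : Prop where
  apply_left_right : ∀ a b, e (α a) (β b) = p.dual b a
  isotropic_left : ∀ a a', e (α a) (α a') = 1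
  isotropic_right : ∀ b b', e (β b) (β b') = 1

namespace IsHyperbolicPair

section Projection

variable {K A B : Type*} [CommGroup K] [TopologicalSpace K] [IsTopologicalGroup K] [CommGroup A]
  [TopologicalSpace A] [CommGroup B] [TopologicalSpace B] {e : K → K → Circle}
  {p : DualPair A B} {α : A →ₜ* K} {β : B →ₜ* K}

/-- The projection of `K` onto `A × B` whose components at `k` represent `e (k, β ·)` and
`e (α ·, k)`. -/
noncomputable def projection (_ : IsHyperbolicPair e p α β) (hn : IsNondegenerateBicharacter e) :
    K →ₜ* A × B :=
  (((p.bidual.symm : PontryaginDual B →ₜ* A).comp ((PontryaginDual.map β).comp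
      ((hn.flat : K →ₜ* PontryaginDual K).comp (ContinuousMonoidHom.inv K))))).prod
    ((p.dual.symm : PontryaginDual A →ₜ* B).comp
      ((PontryaginDual.map α).comp (hn.flat : K →ₜ* PontryaginDual K)))

variable (h : IsHyperbolicPair e p α β) (he : IsAlternatingBicharacter e)
  (hn : IsNondegenerateBicharacter e)

include he in
theorem dual_projection_fst (k : K) (b : B) : p.dual b (h.projection hn k).1 = e k (β b) := by
  change p.dual b (p.bidual.symm (PontryaginDual.map β (hn.flat k⁻¹))) = _
  rw [← p.bidual_apply, ContinuousMulEquiv.apply_symm_apply, PontryaginDual.map_apply,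
    hn.flat_apply, he.inv_right, ← he.swap]

theorem dual_projection_snd (k : K) (a : A) : p.dual (h.projection hn k).2 a = e (α a) k := by
  change p.dual (p.dual.symm (PontryaginDual.map α (hn.flat k))) a = _
  rw [ContinuousMulEquiv.apply_symm_apply, PontryaginDual.map_apply, hn.flat_apply]

include he in
theorem leftInverse_projection : Function.LeftInverse (h.projection hn) (α.coprod β) := by
  rintro ⟨a, b⟩
  refine Prod.ext (p.left_ext fun b' => ?_) (p.right_ext fun a' => ?_)
  · rw [h.dual_projection_fst he]
    change e (α a * β b) (β b') = _
    rw [he.mul_left, h.apply_left_right, h.isotropic_right, mul_one]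
  · rw [h.dual_projection_snd]
    change e (α a') (α a * β b) = _
    rw [he.mul_right, h.apply_left_right, h.isotropic_left, one_mul]

/-- The orthogonal complement of the images of `α` and `β`. -/
noncomputable def complement : Subgroup K := (h.projection hn).toMonoidHom.ker

theorem apply_left_complement (a : A) (k : h.complement hn) : e (α a) k = 1 := by
  rw [← h.dual_projection_snd hn, show h.projection hn k = 1 from k.2, Prod.snd_one, map_one,
    PontryaginDual.one_apply]

include he in
theorem apply_complement_right (k : h.complement hn) (b : B) : e k (β b) = 1 := by
  rw [← h.dual_projection_fst he hn, show h.projection hn k = 1 from k.2, Prod.fst_one, map_one]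

/-- The projection onto the orthogonal complement. -/
noncomputable def retraction : K →ₜ* h.complement hn :=
  kerRetraction (h.leftInverse_projection he hn)

theorem retraction_left (a : A) : h.retraction he hn (α a) = 1 := by
  have := kerRetraction_section (h.leftInverse_projection he hn) (a, 1)
  rwa [show α.coprod β (a, 1) = α a by
    change α a * β 1 = α a
    rw [map_one, mul_one]] at this

theorem retraction_right (b : B) : h.retraction he hn (β b) = 1 := by
  have := kerRetraction_section (h.leftInverse_projection he hn) (1, b)
  rwa [show α.coprod β (1, b) = β b by
    change α 1 * β b = β b
    rw [map_one, one_mul]] at this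

theorem surjective_retraction : Function.Surjective (h.retraction he hn) :=
  surjective_kerRetraction _

theorem isOpenMap_retraction : IsOpenMap (h.retraction he hn) := isOpenMap_kerRetraction _

include he in
theorem isNondegenerateBicharacter_complement :
    IsNondegenerateBicharacter fun k l : h.complement hn => e k l := by
  refine hn.of_retraction he ⟨(h.complement hn).subtype, continuous_subtype_val⟩
    (h.retraction he hn) (kerRetraction_coe _) fun k l => ?_
  change e k (l * (α (h.projection hn l).1 * β (h.projection hn l).2)⁻¹) = e k l
  rw [he.mul_right, he.inv_right, he.mul_right, he.swap (α _), h.apply_left_complement hn,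
    h.apply_complement_right he hn, inv_one, mul_one, inv_one, mul_one]

include he in
theorem apply_mul_complement (a a' : A) (b b' : B) (k k' : h.complement hn) :
    e (α a * β b * k) (α a' * β b' * k') = p.dual b' a * (p.dual b a')⁻¹ * e k k' := by
  have hkα : e k (α a') = 1 := by rw [he.swap, h.apply_left_complement hn, inv_one]
  have hβk : e (β b) k' = 1 := by rw [he.swap, h.apply_complement_right he hn, inv_one]
  have hβα : e (β b) (α a') = (p.dual b a')⁻¹ := by rw [he.swap, h.apply_left_right]
  simp only [he.mul_left, he.mul_right, h.isotropic_left, h.isotropic_right, h.apply_left_right,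
    h.apply_left_complement hn, h.apply_complement_right he hn, hkα, hβk, hβα, one_mul, mul_one]

end Projection

theorem hasPolarization_of_complement {K : Type u} [CommGroup K] [TopologicalSpace K]
    [IsTopologicalGroup K] {A B : Type} [CommGroup A] [TopologicalSpace A] [CommGroup B]
    [TopologicalSpace B] {e : K → K → Circle} {p : DualPair A B} {α : A →ₜ* K} {β : B →ₜ* K}
    (h : IsHyperbolicPair e p α β) (he : IsAlternatingBicharacter e)
    (hn : IsNondegenerateBicharacter e) (hA : IsEuclideanTimesDiscrete A)
    (hlA : HasLifts.{u, v} A) (hlB : HasLifts.{u, v} B)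
    (hc : HasPolarization.{u, v} fun k l : h.complement hn => e k l) :
    HasPolarization.{u, v} e := by
  obtain ⟨A', _, _, hA', hlA', hlB', ψ, hψ⟩ := hc
  let φ : (A × A') × PontryaginDual (A × A') ≃ₜ* K :=
    ((prodCongrContinuous (.refl _) (pontryaginDualProd A A').symm).trans
      (prodProdProdCommContinuous _ _ _ _)).trans
      ((prodCongrContinuous (prodCongrContinuous (.refl A) p.dual.symm) ψ).trans
        (prodKerEquiv (h.leftInverse_projection he hn)))
  refine ⟨A × A', inferInstance, inferInstance, hA.prod hA', hlA.prod hlA',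
    ((hlB.of_equiv p.dual).prod hlB').of_equiv (pontryaginDualProd A A'), φ, ?_⟩
  have hφ : ∀ x y χ, φ ((x, y), χ) = α x * β (p.dual.symm ((pontryaginDualProd A A').symm χ).1) *
      ψ (y, ((pontryaginDualProd A A').symm χ).2) := fun _ _ _ => rfl
  rintro ⟨x, y⟩ ⟨x', y'⟩ χ χ'
  rw [hφ, hφ, h.apply_mul_complement he hn, p.dual.apply_symm_apply, p.dual.apply_symm_apply]
  refine (congrArg _ (hψ y y' _ _)).trans ?_
  rw [mul_mul_mul_comm, ← mul_inv, pontryaginDualProd_symm_fst_mul_snd,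
    pontryaginDualProd_symm_fst_mul_snd]

end IsHyperbolicPair

section CircleCocycle

open Set

theorem exists_continuous_circle_exp_eq {X : Type*} [TopologicalSpace X] [SimplyConnectedSpace X]
    [LocallyPathConnectedSpace X] {f : X → Circle} (hf : Continuous f) :
    ∃ F : X → ℝ, Continuous F ∧ ∀ x, Circle.exp (F x) = f x := by
  have x₀ : X := Classical.arbitrary X
  obtain ⟨t₀, ht₀⟩ := Circle.exp_surjective (f x₀)
  obtain ⟨F, ⟨-, hF⟩, -⟩ :=
    Circle.isCoveringMap_exp.existsUnique_continuousMap_lifts ⟨f, hf⟩ x₀ t₀ ht₀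
  exact ⟨F, F.continuous, congrFun hF⟩

/-- Averaging the cocycle identity over a period in the last variable. -/
theorem exists_real_coboundary {γ : ℝ → ℝ → ℝ} (hγ : Continuous (Function.uncurry γ))
    (hper : ∀ t, Function.Periodic (γ t) 1)
    (hco : ∀ t u w, γ t u + γ (t + u) w = γ u w + γ t (u + w)) :
    ∃ η : ℝ → ℝ, Continuous η ∧ ∀ t u, γ t u + η (t + u) = η t + η u := by
  refine ⟨fun t => ∫ w in (0 : ℝ)..1, γ t w,
    intervalIntegral.continuous_parametric_intervalIntegral_of_continuous' hγ 0 1, fun t u => ?_⟩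
  have hi : ∀ t, IntervalIntegrable (γ t) volume 0 1 := fun t =>
    (hγ.uncurry_left t).intervalIntegrable 0 1
  have hi' : IntervalIntegrable (fun w => γ t (u + w)) volume 0 1 :=
    ((hγ.uncurry_left t).comp (continuous_const_add u)).intervalIntegrable 0 1
  have hshift : ∫ w in (0 : ℝ)..1, γ t (u + w) = ∫ w in (0 : ℝ)..1, γ t w := by
    rw [intervalIntegral.integral_comp_add_left (γ t) u, add_zero,
      (hper t).intervalIntegral_add_eq u 0, zero_add]
  calc γ t u + ∫ w in (0 : ℝ)..1, γ (t + u) w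
      = ∫ w in (0 : ℝ)..1, (γ t u + γ (t + u) w) := by
        rw [intervalIntegral.integral_add (by simp) (hi _)]
        simp
    _ = ∫ w in (0 : ℝ)..1, (γ u w + γ t (u + w)) := by simp only [hco]
    _ = (∫ w in (0 : ℝ)..1, γ t w) + ∫ w in (0 : ℝ)..1, γ u w := by
        rw [intervalIntegral.integral_add (hi _) hi', hshift, add_comm]

theorem exists_circle_coboundary {C : ℝ → ℝ → Circle} (hC : Continuous (Function.uncurry C))
    (hper : ∀ t, Function.Periodic (C t) 1)
    (hco : ∀ t u w, C t u * C (t + u) w = C u w * C t (u + w)) :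
    ∃ c : ℝ → Circle, Continuous c ∧ ∀ t u, C t u * c (t + u) = c t * c u := by
  obtain ⟨γ, hγ, hγC⟩ := exists_continuous_circle_exp_eq hC
  simp only [Function.uncurry, Prod.forall] at hγC
  have hconst : ∀ u, C 0 u = C 0 0 := fun u => by
    have h := hco 0 0 u
    rw [add_zero, zero_add] at h
    exact (mul_right_cancel h).symm
  have hγ0 : γ (0, 1) = γ (0, 0) := by
    have h := Circle.isCoveringMap_exp.eq_of_comp_eq (g₁ := fun u => γ (0, u))
      (g₂ := fun _ => γ (0, 0)) (by fun_prop) continuous_const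
      (funext fun u => by simp only [Function.comp_apply, hγC, hconst u]) 0 rfl
    exact congrFun h 1
  have hγper : (fun q : ℝ × ℝ => γ (q.1, q.2 + 1)) = γ :=
    Circle.isCoveringMap_exp.eq_of_comp_eq (by fun_prop) hγ
      (funext fun q => by
        simp only [Function.comp_apply, hγC, hper q.1 q.2]) (0, 0) (by rw [zero_add, hγ0])
  have hγco : (fun q : ℝ × ℝ × ℝ => γ (q.1, q.2.1) + γ (q.1 + q.2.1, q.2.2)) =
      fun q => γ (q.2.1, q.2.2) + γ (q.1, q.2.1 + q.2.2) :=
    Circle.isCoveringMap_exp.eq_of_comp_eq (by fun_prop) (by fun_prop)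
      (funext fun q => by simp only [Function.comp_apply, Circle.exp_add, hγC, hco])
      (0, 0, 0) (by simp only [add_zero])
  obtain ⟨η, hη, hηγ⟩ := exists_real_coboundary (γ := Function.curry γ) hγ
    (fun t u => congrFun hγper (t, u)) fun t u w => congrFun hγco (t, u, w)
  refine ⟨fun t => Circle.exp (η t), Circle.exp.continuous.comp hη, fun t u => ?_⟩
  rw [← hγC, ← Circle.exp_add, ← Circle.exp_add, ← hηγ]
  rfl

end CircleCocycle

section QuasiPeriodic

open Set Filter

variable {G : Type*} [Group G]

/-- The extension to `ℝ` of a path `s` on `[0, 1]` with `s 0 = 1`, multiplied by `s 1` over each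
period. -/
noncomputable def quasiPeriodicExtension (s : ℝ → G) (t : ℝ) : G :=
  s (Int.fract t) * s 1 ^ ⌊t⌋

theorem quasiPeriodicExtension_add_intCast (s : ℝ → G) (t : ℝ) (n : ℤ) :
    quasiPeriodicExtension s (t + n) = quasiPeriodicExtension s t * s 1 ^ n := by
  simp only [quasiPeriodicExtension, Int.fract_add_intCast, Int.floor_add_intCast, zpow_add,
    mul_assoc]

theorem quasiPeriodicExtension_eqOn_Icc {s : ℝ → G} (hs0 : s 0 = 1) :
    EqOn (quasiPeriodicExtension s) s (Icc 0 1) := by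
  intro t ht
  rcases ht.2.eq_or_lt with rfl | h
  · simp [quasiPeriodicExtension, hs0]
  · simp [quasiPeriodicExtension, Int.floor_eq_zero_iff.2 ⟨ht.1, h⟩,
      Int.fract_eq_self.2 ⟨ht.1, h⟩]

theorem continuous_quasiPeriodicExtension [TopologicalSpace G] [IsTopologicalGroup G] {s : ℝ → G}
    (hs : ContinuousOn s (Icc 0 1)) (hs0 : s 0 = 1) : Continuous (quasiPeriodicExtension s) := by
  set T := quasiPeriodicExtension s
  have hpos : ContinuousOn T (Icc 0 1) := hs.congr (quasiPeriodicExtension_eqOn_Icc hs0)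
  have hneg : ContinuousOn T (Icc (-1) 0) := by
    have h : ContinuousOn (fun t => T (t + 1) * (s 1)⁻¹) (Icc (-1) 0) :=
      (hpos.comp (by fun_prop) fun t ht => ⟨by linarith [ht.1], by linarith [ht.2]⟩).mul
        continuousOn_const
    refine h.congr fun t _ => ?_
    have ht := quasiPeriodicExtension_add_intCast s t 1
    rw [Int.cast_one, zpow_one] at ht
    exact eq_mul_inv_of_mul_eq ht.symm
  have hsymm : ContinuousOn T (Icc (-1) 1) := by
    have h := hneg.union_of_isClosed hpos isClosed_Icc isClosed_Icc
    rwa [Icc_union_Icc_eq_Icc (by norm_num) (by norm_num)] at h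
  refine continuous_iff_continuousAt.2 fun t => ?_
  have ht : ContinuousAt T (t - ⌊t⌋) := hsymm.continuousAt (Icc_mem_nhds
    (by linarith [Int.floor_le t]) (by linarith [Int.lt_floor_add_one t]))
  have hmul : ContinuousAt (fun u => T (u - ⌊t⌋) * s 1 ^ ⌊t⌋) t :=
    (ContinuousAt.comp (f := fun u => u - (⌊t⌋ : ℝ)) ht (by fun_prop)).mul continuousAt_const
  refine hmul.congr (Eventually.of_forall fun u => ?_)
  exact (quasiPeriodicExtension_add_intCast s _ _).symm.trans (by rw [sub_add_cancel])

end QuasiPeriodic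

section CircleExtension

open Topology Filter Set

theorem exists_inl_eq_of_rightHom_eq_one {N E G : Type*} [Group N] [Group E] [Group G]
    (S : GroupExtension N E G) {g : E} (h : S.rightHom g = 1) : ∃ n, S.inl n = g := by
  have hg : g ∈ S.rightHom.ker := h
  rwa [← S.range_inl_eq_ker_rightHom] at hg

/-- The component of `φ (z g)`, as a function of `z ∈ U(1)`, along the tautological character. -/
noncomputable def circleAverage {G : Type*} [Mul G] (ι : Circle → G) (φ : G → ℂ) (g : G) : ℂ :=
  ∫ θ in (-Real.pi)..Real.pi, (Circle.exp (-θ) : ℂ) * φ (ι (Circle.exp θ) * g)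

theorem continuous_circleAverage {G : Type*} [Mul G] [TopologicalSpace G] [ContinuousMul G]
    {ι : Circle → G} (hι : Continuous ι) {φ : G → ℂ} (hφ : Continuous φ) :
    Continuous (circleAverage ι φ) :=
  intervalIntegral.continuous_parametric_intervalIntegral_of_continuous' (by fun_prop) _ _

theorem circleAverage_inl_mul {G : Type*} [Group G] (ι : Circle →* G) (φ : G → ℂ) (z : Circle)
    (g : G) : circleAverage ι φ (ι z * g) = z * circleAverage ι φ g := by
  obtain ⟨θ₀, rfl⟩ := Circle.exp_surjective z
  set F : ℝ → ℂ := fun θ => (Circle.exp (-θ) : ℂ) * φ (ι (Circle.exp θ) * g) with hF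
  have hper : Function.Periodic F (2 * Real.pi) := fun θ => by
    simp only [hF]
    rw [Circle.periodic_exp θ, neg_add, ← sub_eq_add_neg, Circle.periodic_exp.sub_eq]
  have hshift : ∀ θ, (Circle.exp (-θ) : ℂ) * φ (ι (Circle.exp θ) * (ι (Circle.exp θ₀) * g)) =
      (Circle.exp θ₀ : ℂ) * F (θ + θ₀) := fun θ => by
    simp only [hF]
    rw [← mul_assoc (ι _), ← map_mul, ← Circle.exp_add, ← mul_assoc, ← Circle.coe_mul,
      ← Circle.exp_add, neg_add_rev, add_neg_cancel_left]
  have hperiod := hper.intervalIntegral_add_eq (-Real.pi + θ₀) (-Real.pi)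
  rw [show -Real.pi + θ₀ + 2 * Real.pi = Real.pi + θ₀ by ring,
    show -Real.pi + 2 * Real.pi = Real.pi by ring] at hperiod
  simp only [circleAverage, hshift]
  rw [intervalIntegral.integral_const_mul, intervalIntegral.integral_comp_add_right, hperiod]

theorem re_circleAverage {G : Type*} [Mul G] [TopologicalSpace G] [ContinuousMul G]
    {ι : Circle → G} (hι : Continuous ι) {ψ : G → ℝ} (hψ : Continuous ψ) (g : G) :
    (circleAverage ι (fun g => ψ g) g).re =
      ∫ θ in (-Real.pi)..Real.pi, Real.cos θ * ψ (ι (Circle.exp θ) * g) := by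
  have hc : Continuous fun θ : ℝ =>
      (Circle.exp (-θ) : ℂ) * ((ψ (ι (Circle.exp θ) * g) : ℝ) : ℂ) := by fun_prop
  refine (Complex.reCLM.intervalIntegral_comp_comm (hc.intervalIntegrable _ _)).symm.trans ?_
  refine intervalIntegral.integral_congr fun θ _ => ?_
  simp only [Complex.reCLM_apply, Complex.re_mul_ofReal]
  rw [Circle.coe_exp, Complex.exp_ofReal_mul_I_re, Real.cos_neg]

/-- The direction `f x / |f x|` as an element of the circle, with value `1` where `f` vanishes. -/
noncomputable def phase {X : Type*} (f : X → ℂ) (x : X) : Circle :=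
  Circle.exp (f x).arg

theorem coe_phase {X : Type*} {f : X → ℂ} {x : X} (hx : f x ≠ 0) :
    (phase f x : ℂ) = f x / ‖f x‖ := by
  rw [eq_div_iff (by simpa using hx), phase, Circle.coe_exp, mul_comm,
    Complex.norm_mul_exp_arg_mul_I]

theorem continuousAt_phase {X : Type*} [TopologicalSpace X] {f : X → ℂ} (hf : Continuous f) {x : X}
    (hx : f x ≠ 0) : ContinuousAt (phase f) x := by
  refine (IsInducing.subtypeVal (t := {z : ℂ | z ∈ Submonoid.unitSphere ℂ})).continuousAt_iff.2 ?_
  have h : ContinuousAt (fun x => f x / (‖f x‖ : ℂ)) x := by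
    refine hf.continuousAt.div (Complex.continuous_ofReal.comp hf.norm).continuousAt ?_
    simpa using hx
  refine h.congr ?_
  filter_upwards [hf.continuousAt.eventually_ne hx] with y hy using (coe_phase hy).symm

theorem phase_mul_left {X : Type*} {f : X → ℂ} {x y : X} {z : Circle} (hx : f x ≠ 0)
    (h : f y = z * f x) : phase f y = z * phase f x := by
  have hy : f y ≠ 0 := h ▸ mul_ne_zero z.coe_ne_zero hx
  refine Circle.ext ?_
  rw [Circle.coe_mul, coe_phase hx, coe_phase hy, h, norm_mul, Circle.norm_coe, one_mul,
    mul_div_assoc]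

namespace IsTopologicalCentralExtension

variable {K : Type*} {G : Type*} [CommGroup K] [TopologicalSpace K] [Group G] [TopologicalSpace G]
  {S : GroupExtension Circle G K}

theorem inl_commute (hS : IsTopologicalCentralExtension S) (z : Circle) (g : G) :
    Commute (S.inl z) g := hS.central z g

theorem isClosedEmbedding_inl [T2Space G] (hS : IsTopologicalCentralExtension S) :
    IsClosedEmbedding S.inl :=
  hS.continuous_inl.isClosedEmbedding S.inl_injective

theorem exists_nhds_forall_inl_mem [T2Space G] (hS : IsTopologicalCentralExtension S)
    {W : Set Circle} (hW : W ∈ 𝓝 1) : ∃ U ∈ 𝓝 (1 : G), ∀ z, S.inl z ∈ U → z ∈ W := by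
  have hmap : W ∈ comap S.inl (𝓝 1) := by
    rwa [← map_one S.inl, ← hS.isClosedEmbedding_inl.isInducing.nhds_eq_comap]
  exact hmap

variable [IsTopologicalGroup G]

/-- An equivariant function not vanishing at `1` is the average of a bump function around `1` whose
support meets `U(1)` only in the right half plane. -/
theorem exists_equivariant [T2Space G] (hS : IsTopologicalCentralExtension S) :
    ∃ f : G → ℂ, Continuous f ∧ f 1 ≠ 0 ∧ ∀ (z : Circle) g, f (S.inl z * g) = z * f g := by
  have hW : {z : Circle | 0 < (z : ℂ).re} ∈ 𝓝 (1 : Circle) :=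
    (isOpen_lt continuous_const (by fun_prop)).mem_nhds (by simp)
  obtain ⟨V, hV, hVW⟩ := hS.exists_nhds_forall_inl_mem hW
  obtain ⟨U, hUV, hU, h1U⟩ := mem_nhds_iff.1 hV
  let : UniformSpace G := IsTopologicalGroup.rightUniformSpace G
  obtain ⟨ψ, hψ, hψ1, hψU⟩ := CompletelyRegularSpace.completely_regular (1 : G) Uᶜ
    hU.isClosed_compl (by simpa using h1U)
  have hφ : Continuous fun g => (1 - ψ g : ℝ) := by fun_prop
  refine ⟨circleAverage S.inl fun g => ((1 - ψ g : ℝ) : ℂ),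
    continuous_circleAverage hS.continuous_inl (Complex.continuous_ofReal.comp hφ), fun h0 => ?_,
    circleAverage_inl_mul S.inl _⟩
  refine absurd (re_circleAverage hS.continuous_inl hφ 1) (ne_of_lt ?_)
  simp only [h0, mul_one]
  refine intervalIntegral.integral_pos (by linarith [Real.pi_pos])
    (Continuous.continuousOn (by have := hS.continuous_inl; fun_prop)) (fun θ _ => ?_)
    ⟨0, ⟨by linarith [Real.pi_pos], Real.pi_pos.le⟩, ?_⟩
  · by_cases hθ : S.inl (Circle.exp θ) ∈ U
    · have hcos : 0 < ((Circle.exp θ : Circle) : ℂ).re := hVW _ (hUV hθ)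
      rw [Circle.coe_exp, Complex.exp_ofReal_mul_I_re] at hcos
      exact mul_nonneg hcos.le (sub_nonneg.2 (ψ _).2.2)
    · simp [hψU hθ]
  · simp [hψ1]

/-- Divided by its phase under an equivariant function, `g` depends on its coset only. -/
theorem exists_local_section [T2Space G] (hS : IsTopologicalCentralExtension S) :
    ∃ O ∈ 𝓝 (1 : K), ∃ s : K → G, ContinuousOn s O ∧ s 1 = 1 ∧ ∀ k, S.rightHom (s k) = k := by
  obtain ⟨f, hf, hf1, hfz⟩ := hS.exists_equivariant
  let q : G → G := fun g => S.inl (phase f g)⁻¹ * g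
  have hqc : ∀ g, f g ≠ 0 → ContinuousAt q g := fun g h =>
    (hS.continuous_inl.continuousAt.comp (continuousAt_phase hf h).inv).mul continuousAt_id
  have hq : ∀ g g', f g ≠ 0 → S.rightHom g = S.rightHom g' → q g' = q g := by
    intro g g' h hgg
    obtain ⟨z, hz⟩ := exists_inl_eq_of_rightHom_eq_one S (g := g' * g⁻¹) (by
      rw [map_mul, map_inv, hgg, mul_inv_cancel])
    obtain rfl : g' = S.inl z * g := by rw [hz, inv_mul_cancel_right]
    simp only [q]
    rw [phase_mul_left h (hfz z g), ← mul_assoc, ← map_mul, mul_inv_rev, inv_mul_cancel_right]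
  have hqπ : ∀ g, S.rightHom (q g) = S.rightHom g := fun g => by
    rw [map_mul, S.rightHom_inl, one_mul]
  let σ : K → G := Function.surjInv S.rightHom_surjective
  have hσ : ∀ k, S.rightHom (σ k) = k := Function.surjInv_eq S.rightHom_surjective
  refine ⟨S.rightHom '' {g | f g ≠ 0}, ?_, fun k => q (σ k) * (q (σ 1))⁻¹, ?_, mul_inv_cancel _,
    fun k => ?_⟩
  · exact (hS.isOpenQuotientMap_rightHom.isOpenMap _
      (isOpen_ne_fun hf continuous_const)).mem_nhds ⟨1, hf1, map_one _⟩
  · rintro _ ⟨g, hg, rfl⟩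
    refine ContinuousAt.continuousWithinAt ?_
    rw [← hS.isOpenQuotientMap_rightHom.continuousAt_comp_iff]
    refine ContinuousAt.mul ((hqc g hg).congr ?_) continuousAt_const
    filter_upwards [hf.continuousAt.eventually_ne hg] with x hx
    exact (hq x _ hx (hσ _).symm).symm
  · rw [map_mul, map_inv, hqπ, hqπ, hσ, hσ, inv_one, mul_one]

end IsTopologicalCentralExtension

end CircleExtension

section Lifts

open Topology Filter Set

namespace IsTopologicalCentralExtension

variable {K : Type*} {G : Type*} [CommGroup K] [TopologicalSpace K] [Group G] [TopologicalSpace G]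
  [IsTopologicalGroup G] [T2Space G] {S : GroupExtension Circle G K}

/-- The cocycle `T t * T u * (T (t + u))⁻¹` is periodic in `u`, so it is a coboundary. -/
theorem exists_lift_of_quasiPeriodic (hS : IsTopologicalCentralExtension S)
    {a : Multiplicative ℝ →* K} {T : ℝ → G} (hT : Continuous T)
    (hTa : ∀ t, S.rightHom (T t) = a (.ofAdd t)) {p : G} (hTp : ∀ t, T (t + 1) = T t * p) :
    ∃ σ : Multiplicative ℝ →ₜ* G, ∀ t, S.rightHom (σ t) = a t := by
  have hCex : ∀ t u, ∃ z, S.inl z = T t * T u * (T (t + u))⁻¹ := fun t u =>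
    exists_inl_eq_of_rightHom_eq_one S (by
      rw [map_mul, map_mul, map_inv, hTa, hTa, hTa, ofAdd_add, map_mul, mul_inv_cancel])
  choose C hC using hCex
  have hCmul : ∀ t u, T t * T u = S.inl (C t u) * T (t + u) := fun t u => by
    rw [hC, inv_mul_cancel_right]
  have hCc : Continuous (Function.uncurry C) := by
    rw [hS.isClosedEmbedding_inl.isInducing.continuous_iff]
    refine Continuous.congr (f := fun q : ℝ × ℝ => T q.1 * T q.2 * (T (q.1 + q.2))⁻¹)
      (by fun_prop) fun q => (hC q.1 q.2).symm
  have hCper : ∀ t, Function.Periodic (C t) 1 := fun t u => by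
    apply S.inl_injective
    rw [hC, hC, ← add_assoc, hTp, hTp, mul_inv_rev, ← mul_assoc, ← mul_assoc, mul_inv_cancel_right]
  have hCco : ∀ t u w, C t u * C (t + u) w = C u w * C t (u + w) := by
    intro t u w
    refine S.inl_injective (mul_right_cancel (b := T (t + u + w)) ?_)
    calc S.inl (C t u * C (t + u) w) * T (t + u + w)
        = T t * T u * T w := by rw [map_mul, mul_assoc, ← hCmul, ← mul_assoc, ← hCmul]
      _ = S.inl (C u w) * (T t * T (u + w)) := by
        rw [mul_assoc, hCmul u w, ← mul_assoc, ← mul_assoc, (hS.inl_commute _ (T t)).eq]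
      _ = S.inl (C u w * C t (u + w)) * T (t + u + w) := by
        rw [hCmul, map_mul, mul_assoc, add_assoc]
  obtain ⟨c, hc, hcC⟩ := exists_circle_coboundary hCc hCper hCco
  refine ⟨⟨MonoidHom.mk' (fun t => S.inl (c t.toAdd)⁻¹ * T t.toAdd) fun t u => ?_, ?_⟩,
    fun t => ?_⟩
  · have hcoe : (c (t.toAdd + u.toAdd))⁻¹ =
        (c t.toAdd)⁻¹ * (c u.toAdd)⁻¹ * C t.toAdd u.toAdd := by
      rw [← mul_inv, ← hcC, mul_inv_rev, inv_mul_cancel_right]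
    rw [toAdd_mul, hcoe, map_mul, map_mul, mul_assoc, ← hCmul,
      (hS.inl_commute _ _).mul_mul_mul_comm]
  · have := hS.continuous_inl
    have := continuous_toAdd (X := ℝ)
    exact (by fun_prop : Continuous fun t : Multiplicative ℝ => S.inl (c t.toAdd)⁻¹ * T t.toAdd)
  · change S.rightHom (S.inl _ * T t.toAdd) = a t
    rw [map_mul, S.rightHom_inl, one_mul, hTa, ofAdd_toAdd]

theorem exists_lift_of_continuousOn_Icc (hS : IsTopologicalCentralExtension S)
    {a : Multiplicative ℝ →* K} {s : ℝ → G} (hs : ContinuousOn s (Icc 0 1)) (hs0 : s 0 = 1)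
    (hsa : ∀ t, S.rightHom (s t) = a (.ofAdd t)) :
    ∃ σ : Multiplicative ℝ →ₜ* G, ∀ t, S.rightHom (σ t) = a t := by
  refine hS.exists_lift_of_quasiPeriodic (continuous_quasiPeriodicExtension hs hs0) (fun t => ?_)
    (p := s 1) fun t => ?_
  · rw [quasiPeriodicExtension, map_mul, map_zpow, hsa, hsa, ← map_zpow, ← map_mul, ← ofAdd_zsmul,
      ← ofAdd_add, zsmul_one, Int.fract_add_floor]
  · simpa using quasiPeriodicExtension_add_intCast s t 1

theorem exists_lift_real (hS : IsTopologicalCentralExtension S) (a : Multiplicative ℝ →ₜ* K) :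
    ∃ σ : Multiplicative ℝ →ₜ* G, ∀ t, S.rightHom (σ t) = a t := by
  obtain ⟨O, hO, s, hs, hs1, hsπ⟩ := hS.exists_local_section
  have ha : Continuous fun t : ℝ => a (.ofAdd t) := (map_continuous a).comp continuous_ofAdd
  have hnear : ∀ᶠ t in 𝓝 (0 : ℝ), a (.ofAdd t) ∈ O :=
    ha.continuousAt.eventually_mem (by rwa [ofAdd_zero, map_one])
  obtain ⟨ε, hε, hball⟩ := Metric.eventually_nhds_iff.1 hnear
  obtain ⟨δ, hδ, hδε⟩ := exists_between hε
  have hIcc : ∀ t ∈ Icc (0 : ℝ) 1, a (.ofAdd (δ * t)) ∈ O := fun t ht => hball (by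
    rw [Real.dist_0_eq_abs, abs_of_nonneg (mul_nonneg hδ.le ht.1)]
    nlinarith [ht.2])
  let scale (r : ℝ) : Multiplicative ℝ →ₜ* Multiplicative ℝ :=
    ⟨(AddMonoidHom.mulLeft r).toMultiplicative,
      continuous_ofAdd.comp ((continuous_const_mul r).comp continuous_toAdd)⟩
  obtain ⟨σ, hσ⟩ := hS.exists_lift_of_continuousOn_Icc (a := (a.comp (scale δ)).toMonoidHom)
    (s := fun t => s (a (.ofAdd (δ * t))))
    (hs.comp (ha.comp (continuous_const_mul δ)).continuousOn hIcc)
    (by rw [mul_zero, ofAdd_zero, map_one, hs1]) fun t => hsπ _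
  refine ⟨σ.comp (scale δ⁻¹), fun t => (hσ _).trans ?_⟩
  exact congrArg (fun r => a (.ofAdd r)) (mul_inv_cancel_left₀ hδ.ne' t.toAdd)

end IsTopologicalCentralExtension

theorem hasLifts_punit : HasLifts.{u, v} PUnit := by
  intro K G _ _ _ _ _ _ S _ α _
  exact ⟨1, fun _ => (map_one S.rightHom).trans (map_one α).symm⟩

theorem hasLifts_real : HasLifts.{u, v} (Multiplicative ℝ) := by
  intro K G _ _ _ _ _ _ S hS α _
  exact hS.exists_lift_real α

theorem hasLifts_int : HasLifts.{u, v} (Multiplicative ℤ) := by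
  intro K G _ _ _ _ _ _ S _ α _
  obtain ⟨g, hg⟩ := S.rightHom_surjective (α (.ofAdd 1))
  refine ⟨⟨zpowersHom G g, continuous_of_discreteTopology⟩, fun n => ?_⟩
  change S.rightHom (g ^ n.toAdd) = α n
  rw [map_zpow, hg, ← map_zpow, ← ofAdd_zsmul, zsmul_one, Int.cast_id, ofAdd_toAdd]

theorem exists_circle_pow_eq (z : Circle) {n : ℕ} (hn : n ≠ 0) : ∃ w : Circle, w ^ n = z := by
  obtain ⟨t, rfl⟩ := Circle.exp_surjective z
  refine ⟨Circle.exp (t / n), ?_⟩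
  rw [← Circle.exp_natCast_mul, mul_div_cancel₀ _ (by exact_mod_cast hn)]

/-- A preimage of the generator can be rescaled by `U(1)` to have the right order. -/
theorem hasLifts_zmod (n : ℕ) [NeZero n] : HasLifts.{u, v} (Multiplicative (ZMod n)) := by
  intro K G _ _ _ _ _ _ S hS α _
  obtain ⟨g, hg⟩ := S.rightHom_surjective (α (.ofAdd 1))
  have hαn : ∀ m : ℕ, α (.ofAdd 1) ^ m = α (.ofAdd (m : ZMod n)) := fun m => by
    rw [← map_pow, ← ofAdd_nsmul, nsmul_one]
  obtain ⟨z, hz⟩ := exists_inl_eq_of_rightHom_eq_one S (g := g ^ n) (by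
    rw [map_pow, hg, hαn, ZMod.natCast_self, ofAdd_zero, map_one])
  obtain ⟨w, hw⟩ := exists_circle_pow_eq z⁻¹ (NeZero.ne n)
  have hpow : (S.inl w * g) ^ n = 1 := by
    rw [(hS.inl_commute w g).mul_pow, ← map_pow, hw, ← hz, ← map_mul, inv_mul_cancel, map_one]
  refine ⟨⟨MonoidHom.mk' (fun a => (S.inl w * g) ^ a.toAdd.val) fun a b => ?_,
    continuous_of_discreteTopology⟩, fun a => ?_⟩
  · rw [toAdd_mul, ZMod.val_add, ← pow_eq_pow_mod _ hpow, pow_add]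
  · change S.rightHom ((S.inl w * g) ^ a.toAdd.val) = α a
    rw [map_pow, map_mul, S.rightHom_inl, one_mul, hg, hαn, ZMod.natCast_zmod_val, ofAdd_toAdd]

theorem exists_circle_hom_exp {G : Type*} [Group G] [TopologicalSpace G]
    (τ : Multiplicative ℝ →ₜ* G) (hτ : τ (.ofAdd (2 * Real.pi)) = 1) :
    ∃ σ : Circle →ₜ* G, ∀ t, σ (Circle.exp t) = τ (.ofAdd t) := by
  have hσ : ∀ t : ℝ, τ (.ofAdd (Complex.arg (Circle.exp t))) = τ (.ofAdd t) := fun t => by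
    obtain ⟨m, hm⟩ := Circle.exp_eq_exp.1 (Circle.exp_arg (Circle.exp t))
    rw [hm, ofAdd_add, map_mul, ← zsmul_eq_mul, ofAdd_zsmul, map_zpow, hτ, one_zpow, mul_one]
  refine ⟨⟨MonoidHom.mk' (fun w : Circle => τ (.ofAdd (Complex.arg w))) fun w w' => ?_, ?_⟩, hσ⟩
  · obtain ⟨s, rfl⟩ := Circle.exp_surjective w
    obtain ⟨t, rfl⟩ := Circle.exp_surjective w'
    rw [← Circle.exp_add, hσ, hσ, hσ, ofAdd_add, map_mul]
  · have hquot : IsQuotientMap Circle.exp :=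
      Circle.isCoveringMap_exp.isQuotientMap Circle.exp_surjective
    refine hquot.continuous_iff.2 (Continuous.congr ?_ fun t => (hσ t).symm)
    exact (map_continuous τ).comp continuous_ofAdd

/-- A lift of `t ↦ α (exp t)` is multiplied by a character of `ℝ` to have period `2π`. -/
theorem hasLifts_circle : HasLifts.{u, v} Circle := by
  intro K G _ _ _ _ _ _ S hS α _
  let exp : Multiplicative ℝ →ₜ* Circle :=
    ⟨MonoidHom.mk' (fun t => Circle.exp t.toAdd) fun s t => Circle.exp_add _ _,
      Circle.exp.continuous.comp continuous_toAdd⟩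
  obtain ⟨ρ, hρ⟩ := hS.exists_lift_real (α.comp exp)
  obtain ⟨z, hz⟩ := exists_inl_eq_of_rightHom_eq_one S (g := ρ (.ofAdd (2 * Real.pi))) (by
    refine (hρ _).trans ?_
    change α (Circle.exp (2 * Real.pi)) = 1
    rw [Circle.exp_two_pi, map_one])
  obtain ⟨θ, rfl⟩ := Circle.exp_surjective z
  let c : ℝ → Circle := fun t => Circle.exp (-(θ * (t / (2 * Real.pi))))
  have hc : ∀ s t, c (s + t) = c s * c t := fun s t => by
    simp only [c]
    rw [← Circle.exp_add]
    ring_nf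
  have hc2π : c (2 * Real.pi) = Circle.exp (-θ) := by
    simp only [c]
    rw [div_self (by positivity), mul_one]
  let τ : Multiplicative ℝ →ₜ* G :=
    ⟨MonoidHom.mk' (fun t => S.inl (c t.toAdd) * ρ t) fun s t => by
      rw [toAdd_mul, hc, map_mul, map_mul, (hS.inl_commute _ _).mul_mul_mul_comm],
      (hS.continuous_inl.comp (Circle.exp.continuous.comp (by
        have := continuous_toAdd (X := ℝ)
        fun_prop))).mul (map_continuous ρ)⟩
  obtain ⟨σ, hσ⟩ := exists_circle_hom_exp τ (by
    change S.inl (c (2 * Real.pi)) * ρ _ = 1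
    rw [hc2π, ← hz, ← map_mul, ← Circle.exp_add, neg_add_cancel, Circle.exp_zero, map_one])
  refine ⟨σ, fun w => ?_⟩
  obtain ⟨t, rfl⟩ := Circle.exp_surjective w
  rw [hσ]
  change S.rightHom (S.inl _ * ρ _) = _
  rw [map_mul, S.rightHom_inl, one_mul, hρ]
  rfl

end Lifts

section Characters

/-- A continuous bimultiplicative map to the circle. -/
structure IsPairing {A B : Type*} [CommGroup A] [TopologicalSpace A] [CommGroup B]
    [TopologicalSpace B] (p : A → B → Circle) : Prop where
  mul_left : ∀ a a' b, p (a * a') b = p a b * p a' b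
  mul_right : ∀ a b b', p a (b * b') = p a b * p a b'
  continuous_uncurry : Continuous (Function.uncurry p)

namespace IsPairing

variable {A B : Type*} [CommGroup A] [TopologicalSpace A] [CommGroup B] [TopologicalSpace B]
  {p : A → B → Circle}

theorem flip (hp : IsPairing p) : IsPairing fun b a => p a b :=
  ⟨fun b b' a => hp.mul_right a b b', fun b a a' => hp.mul_left a a' b,
    hp.continuous_uncurry.comp continuous_swap⟩

/-- The homomorphism `b ↦ p (·, b)` to the dual group. -/
noncomputable def toDual (hp : IsPairing p) : B →ₜ* PontryaginDual A where
  toFun b := (⟨MonoidHom.mk' (fun a => p a b) fun a a' => hp.mul_left a a' b,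
    hp.continuous_uncurry.comp (by fun_prop : Continuous fun a => (a, b))⟩ : A →ₜ* Circle)
  map_one' := PontryaginDual.ext fun a => (MonoidHom.mk' (p a) (hp.mul_right a)).map_one
  map_mul' b b' := PontryaginDual.ext fun a => hp.mul_right a b b'
  continuous_toFun :=
    ContinuousMonoidHom.continuous_of_continuous_uncurry _ hp.flip.continuous_uncurry

theorem toDual_apply (hp : IsPairing p) (a : A) (b : B) : hp.toDual b a = p a b := rfl

theorem injective_toDual (hp : IsPairing p) (h : ∀ b, (∀ a, p a b = 1) → b = 1) :
    Function.Injective hp.toDual :=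
  (injective_iff_map_eq_one hp.toDual).2 fun b hb => h b fun a => by
    rw [← hp.toDual_apply, hb, PontryaginDual.one_apply]

theorem bijective_flip_toDual {p : A → A → Circle} (hp : IsPairing p)
    (hsymm : ∀ a b, p a b = p b a) (hb : Function.Bijective hp.toDual) :
    Function.Bijective hp.flip.toDual := by
  have h : hp.flip.toDual = hp.toDual :=
    ContinuousMonoidHom.ext fun b => PontryaginDual.ext fun a => hsymm b a
  rwa [h]

section Equiv

variable [IsTopologicalGroup A] [LocallyCompactSpace A] [IsTopologicalGroup B]
  [SigmaCompactSpace B]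

/-- A bijective continuous homomorphism to the dual is open because its source is `σ`-compact. -/
noncomputable def dualEquiv (hp : IsPairing p) (hb : Function.Bijective hp.toDual) :
    B ≃ₜ* PontryaginDual A :=
  .mk' ((Equiv.ofBijective hp.toDual hb).toHomeomorphOfContinuousOpen (map_continuous hp.toDual)
    (MonoidHom.isOpenMap_of_sigmaCompact hp.toDual.toMonoidHom hb.2 (map_continuous hp.toDual)))
    (map_mul hp.toDual)

end Equiv

variable [IsTopologicalGroup A] [LocallyCompactSpace A] [SigmaCompactSpace A]
  [IsTopologicalGroup B] [LocallyCompactSpace B] [SigmaCompactSpace B]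

/-- The dual pair given by a pairing that is perfect on both sides. -/
noncomputable def dualPair (hp : IsPairing p) (hB : Function.Bijective hp.toDual)
    (hA : Function.Bijective hp.flip.toDual) : DualPair A B :=
  ⟨hp.dualEquiv hB, hp.flip.dualEquiv hA, fun _ _ => rfl⟩

end IsPairing

/-- The logarithm of `χ` vanishing at the origin is additive, as its additivity defect is a
continuous function with values in `2πℤ`. -/
theorem exists_linear_of_character {V : Type*} [NormedAddCommGroup V] [NormedSpace ℝ V]
    {χ : V → Circle} (hχ : Continuous χ) (hadd : ∀ v w, χ (v + w) = χ v * χ w) :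
    ∃ l : V →L[ℝ] ℝ, ∀ v, χ v = Circle.exp (2 * Real.pi * l v) := by
  have h0 : χ 0 = 1 := by simpa using hadd 0 0
  obtain ⟨F, ⟨hF0, hF⟩, huniq⟩ := Circle.isCoveringMap_exp.existsUnique_continuousMap_lifts
    (⟨χ, hχ⟩ : C(V, Circle)) 0 0 (by simp [h0])
  have hFχ : ∀ v, Circle.exp (F v) = χ v := congrFun hF
  have hFadd : ∀ v w, F (v + w) = F v + F w := fun v w => by
    have h := huniq ⟨fun v => F (v + w) - F w, by fun_prop⟩ ⟨by simp, funext fun v => by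
      change Circle.exp (F (v + w) - F w) = χ v
      rw [Circle.exp_sub, hFχ, hFχ, hadd, mul_div_cancel_right]⟩
    exact sub_eq_iff_eq_add.1 (DFunLike.congr_fun h v)
  let L : V →L[ℝ] ℝ := AddMonoidHom.toRealLinearMap ⟨⟨F, hF0⟩, hFadd⟩ F.continuous
  refine ⟨(2 * Real.pi)⁻¹ • L, fun v => ?_⟩
  rw [smul_apply, smul_eq_mul, mul_inv_cancel_left₀ (by positivity)]
  exact (hFχ v).symm

theorem exists_mul_of_real_character {χ : ℝ → Circle} (hχ : Continuous χ)
    (hadd : ∀ s t, χ (s + t) = χ s * χ t) :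
    ∃ r : ℝ, ∀ t, χ t = Circle.exp (2 * Real.pi * (t * r)) := by
  obtain ⟨l, hl⟩ := exists_linear_of_character hχ hadd
  refine ⟨l 1, fun t => ?_⟩
  rw [hl, ← smul_eq_mul t, ← map_smul, smul_eq_mul, mul_one]

theorem isPairing_real : IsPairing fun s t : Multiplicative ℝ =>
    Circle.exp (2 * Real.pi * (s.toAdd * t.toAdd)) where
  mul_left s s' t := by rw [toAdd_mul, add_mul, mul_add, Circle.exp_add]
  mul_right s t t' := by rw [toAdd_mul, mul_add, mul_add, Circle.exp_add]
  continuous_uncurry := by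
    have := continuous_toAdd (X := ℝ)
    exact Circle.exp.continuous.comp (by fun_prop)

theorem circle_exp_pi_ne_one : Circle.exp Real.pi ≠ 1 := fun h => by
  have := congrArg (fun z : Circle => (z : ℂ)) h
  norm_num at this

theorem bijective_toDual_real : Function.Bijective isPairing_real.toDual := by
  refine ⟨isPairing_real.injective_toDual fun t ht => by_contra fun hne => ?_, fun χ => ?_⟩
  · have ht0 : t.toAdd ≠ 0 := mt toAdd_eq_zero.1 hne
    refine circle_exp_pi_ne_one (Eq.trans ?_ (ht (.ofAdd (2 * t.toAdd)⁻¹)))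
    rw [toAdd_ofAdd]
    congr 1
    field_simp
  · obtain ⟨r, hr⟩ := exists_mul_of_real_character (χ := fun t => χ (.ofAdd t))
      ((map_continuous χ).comp continuous_ofAdd) fun s t => by rw [ofAdd_add, map_mul]
    exact ⟨.ofAdd r, PontryaginDual.ext fun t => (hr t.toAdd).symm⟩

theorem isPairing_int_circle :
    IsPairing fun (n : Multiplicative ℤ) (z : Circle) => z ^ n.toAdd where
  mul_left n n' z := zpow_add z n.toAdd n'.toAdd
  mul_right n z z' := mul_zpow z z' n.toAdd
  continuous_uncurry := continuous_prod_of_discrete_left.2 fun n => continuous_zpow n.toAdd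

theorem bijective_toDual_int_circle : Function.Bijective isPairing_int_circle.toDual := by
  refine ⟨isPairing_int_circle.injective_toDual fun z hz => ?_, fun χ =>
    ⟨χ (.ofAdd 1), PontryaginDual.ext fun n => ?_⟩⟩
  · simpa using hz (.ofAdd 1)
  · rw [isPairing_int_circle.toDual_apply, ← map_zpow, ← ofAdd_zsmul, zsmul_one, Int.cast_id,
      ofAdd_toAdd]

/-- `1` is not a rational multiple of `π`. -/
theorem circle_exp_one_zpow_eq_one {n : ℤ} : Circle.exp 1 ^ n = 1 ↔ n = 0 := by
  refine ⟨fun h => by_contra fun hn => ?_, fun h => by rw [h, zpow_zero]⟩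
  rw [← Circle.exp_intCast_mul, mul_one] at h
  obtain ⟨m, hm⟩ := Circle.exp_eq_one.1 h
  have hm0 : (m : ℝ) ≠ 0 := fun hm0 =>
    hn (Int.cast_eq_zero.1 (hm.trans (by rw [hm0, zero_mul])))
  refine irrational_pi ⟨n / (2 * m), ?_⟩
  push_cast
  rw [hm]
  field_simp

theorem exists_zpow_of_circle_character (χ : PontryaginDual Circle) :
    ∃ n : ℤ, ∀ z, χ z = z ^ n := by
  obtain ⟨r, hr⟩ := exists_mul_of_real_character (χ := fun t => χ (Circle.exp t))
    ((map_continuous χ).comp Circle.exp.continuous) fun s t => by rw [Circle.exp_add, map_mul]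
  have hperiod : Circle.exp (2 * Real.pi * (2 * Real.pi * r)) = 1 := by
    rw [← hr, Circle.exp_two_pi, map_one]
  obtain ⟨n, hn⟩ := Circle.exp_eq_one.1 hperiod
  have hrn : 2 * Real.pi * r = n :=
    mul_left_cancel₀ (by positivity : 2 * Real.pi ≠ 0) (hn.trans (mul_comm _ _))
  refine ⟨n, fun z => ?_⟩
  obtain ⟨t, rfl⟩ := Circle.exp_surjective z
  rw [hr, ← Circle.exp_intCast_mul, ← hrn]
  congr 1
  ring

theorem bijective_flip_toDual_int_circle :
    Function.Bijective isPairing_int_circle.flip.toDual := by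
  refine ⟨isPairing_int_circle.flip.injective_toDual fun n hn => ?_, fun χ => ?_⟩
  · exact toAdd_eq_zero.1 (circle_exp_one_zpow_eq_one.1 (hn (Circle.exp 1)))
  · obtain ⟨n, hn⟩ := exists_zpow_of_circle_character χ
    exact ⟨.ofAdd n, PontryaginDual.ext fun z => (hn z).symm⟩

theorem exists_toCircle_eq_of_pow_eq_one {n : ℕ} [NeZero n] {w : Circle} (hw : w ^ n = 1) :
    ∃ a : ZMod n, ZMod.toCircle a = w := by
  obtain ⟨i, -, hi⟩ := (Complex.isPrimitiveRoot_exp n (NeZero.ne n)).eq_pow_of_pow_eq_one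
    (ξ := (w : ℂ)) (by rw [← Circle.coe_pow, hw, Circle.coe_one])
  refine ⟨i, Circle.ext ?_⟩
  rw [ZMod.toCircle_natCast, ← hi, ← Complex.exp_nat_mul]
  congr 1
  ring

theorem isPairing_zmod (n : ℕ) [NeZero n] : IsPairing fun a b : Multiplicative (ZMod n) =>
    ZMod.toCircle (a.toAdd * b.toAdd) where
  mul_left a a' b := by rw [toAdd_mul, add_mul, AddChar.map_add_eq_mul]
  mul_right a b b' := by rw [toAdd_mul, mul_add, AddChar.map_add_eq_mul]
  continuous_uncurry := continuous_of_discreteTopology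

theorem bijective_toDual_zmod (n : ℕ) [NeZero n] :
    Function.Bijective (isPairing_zmod n).toDual := by
  refine ⟨(isPairing_zmod n).injective_toDual fun b hb => ?_, fun χ => ?_⟩
  · refine toAdd_eq_zero.1 (ZMod.injective_toCircle ?_)
    rw [AddChar.map_zero_eq_one, ← hb (.ofAdd 1), toAdd_ofAdd, one_mul]
  · have hχ : ∀ m : ℕ, χ (.ofAdd 1) ^ m = χ (.ofAdd (m : ZMod n)) := fun m => by
      rw [← map_pow, ← ofAdd_nsmul, nsmul_one]
    obtain ⟨b, hb⟩ := exists_toCircle_eq_of_pow_eq_one (n := n) (w := χ (.ofAdd 1)) (by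
      rw [hχ, ZMod.natCast_self, ofAdd_zero, map_one])
    refine ⟨.ofAdd b, PontryaginDual.ext fun a => ?_⟩
    rw [(isPairing_zmod n).toDual_apply, toAdd_ofAdd, ← ZMod.natCast_zmod_val a.toAdd,
      ← nsmul_eq_mul, AddChar.map_nsmul_eq_pow, hb, hχ, ZMod.natCast_zmod_val, ofAdd_toAdd]

/-- The self-duality of the line. -/
noncomputable def realDualPair : DualPair (Multiplicative ℝ) (Multiplicative ℝ) :=
  isPairing_real.dualPair bijective_toDual_real
    (isPairing_real.bijective_flip_toDual (fun s t => by rw [mul_comm s.toAdd])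
      bijective_toDual_real)

/-- The duality of the integers and the circle. -/
noncomputable def intCircleDualPair : DualPair (Multiplicative ℤ) Circle :=
  isPairing_int_circle.dualPair bijective_toDual_int_circle bijective_flip_toDual_int_circle

/-- The self-duality of a finite cyclic group. -/
noncomputable def zmodDualPair (n : ℕ) [NeZero n] :
    DualPair (Multiplicative (ZMod n)) (Multiplicative (ZMod n)) :=
  (isPairing_zmod n).dualPair (bijective_toDual_zmod n)
    ((isPairing_zmod n).bijective_flip_toDual (fun a b => by rw [mul_comm])
      (bijective_toDual_zmod n))

end Characters

section Finite

theorem hasPolarization_of_subsingleton {K : Type u} [CommGroup K] [TopologicalSpace K]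
    [Subsingleton K] {e : K → K → Circle} (he : IsAlternatingBicharacter e) :
    HasPolarization.{u, v} e := by
  have eval_eq_one (χ : PontryaginDual PUnit) (x : PUnit) : χ x = 1 := map_one χ
  have : Unique (PontryaginDual PUnit) :=
    ⟨⟨1⟩, fun χ => PontryaginDual.ext fun x => by rw [eval_eq_one, eval_eq_one]⟩
  have : Unique (PUnit × PontryaginDual PUnit) := ⟨⟨1⟩, fun _ => Subsingleton.elim _ _⟩
  have : Unique K := ⟨⟨1⟩, fun _ => Subsingleton.elim _ _⟩
  refine ⟨PUnit, inferInstance, inferInstance, .of_discreteTopology _, hasLifts_punit,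
    hasLifts_punit.of_equiv (.ofUnique), .ofUnique,
    fun x x' χ χ' => ?_⟩
  have apply_eq_one (k l : K) : e k l = 1 := by rw [Subsingleton.elim k 1, he.one_left]
  rw [eval_eq_one, eval_eq_one, inv_one, mul_one, apply_eq_one]

namespace IsAlternatingBicharacter

variable {K : Type*} [CommGroup K] [TopologicalSpace K] {e : K → K → Circle}

theorem eq_one_of_forall_apply_eq_one (he : IsAlternatingBicharacter e)
    (hn : IsNondegenerateBicharacter e) {x : K} (h : ∀ y, e x y = 1) : x = 1 :=
  hn.eq_of_forall_apply_eq fun k => by rw [he.swap, h, he.swap, he.one_left]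

theorem orderOf_dvd_card_range (he : IsAlternatingBicharacter e)
    (hn : IsNondegenerateBicharacter e) (x : K) :
    orderOf x ∣ Nat.card (he.rightHom x).range := by
  refine orderOf_dvd_of_pow_eq_one (he.eq_one_of_forall_apply_eq_one hn fun y => ?_)
  rw [he.pow_left]
  exact congrArg Subtype.val
    (pow_card_eq_one' (x := (⟨e x y, y, rfl⟩ : (he.rightHom x).range)))

/-- The values of `e (x, ·)` are `n`-th roots of unity, and there are at least `n` of them. -/
theorem exists_apply_eq_toCircle [Finite K] (he : IsAlternatingBicharacter e)
    (hn : IsNondegenerateBicharacter e) {n : ℕ} [NeZero n] {x : K} (hx : orderOf x = n) :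
    ∃ y, e x y = ZMod.toCircle (1 : ZMod n) := by
  have : Finite (he.rightHom x).range := Set.finite_range (he.rightHom x)
  have hsub : Set.range (he.rightHom x) ⊆ Set.range (ZMod.toCircle (N := n)) := by
    rintro _ ⟨y, rfl⟩
    refine exists_toCircle_eq_of_pow_eq_one ?_
    change e x y ^ n = 1
    rw [← he.pow_left, ← hx, pow_orderOf_eq_one, he.one_left]
  have hcard : (Set.range (ZMod.toCircle (N := n))).ncard ≤ (Set.range (he.rightHom x)).ncard :=
    calc (Set.range (ZMod.toCircle (N := n))).ncard = n := by
          rw [Set.ncard_range_of_injective ZMod.injective_toCircle, Nat.card_zmod]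
      _ ≤ Nat.card (he.rightHom x).range :=
          Nat.le_of_dvd Nat.card_pos (hx ▸ he.orderOf_dvd_card_range hn x)
  have hrange := Set.eq_of_subset_of_ncard_le hsub hcard (Set.finite_range _)
  exact hrange.symm.subset ⟨1, rfl⟩

end IsAlternatingBicharacter

/-- The homomorphism from `ℤ/n` sending `1` to `x`. -/
noncomputable def zmodHom {K : Type*} [CommGroup K] [TopologicalSpace K] {n : ℕ} [NeZero n] (x : K)
    (hx : x ^ n = 1) : Multiplicative (ZMod n) →ₜ* K :=
  ⟨MonoidHom.mk' (fun a => x ^ a.toAdd.val) fun a b => by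
    rw [toAdd_mul, ZMod.val_add, ← pow_eq_pow_mod _ hx, pow_add], continuous_of_discreteTopology⟩

theorem zmodHom_apply {K : Type*} [CommGroup K] [TopologicalSpace K] {n : ℕ} [NeZero n] {x : K}
    (hx : x ^ n = 1) (a : Multiplicative (ZMod n)) : zmodHom x hx a = x ^ a.toAdd.val := rfl

theorem zmodHom_natCast_one {K : Type*} [CommGroup K] [TopologicalSpace K] {n : ℕ} [NeZero n]
    {x : K} (hx : x ^ n = 1) : zmodHom x hx (.ofAdd ((1 : ℕ) : ZMod n)) = x := by
  rw [zmodHom_apply, toAdd_ofAdd, ZMod.val_natCast, ← pow_eq_pow_mod _ hx, pow_one]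

theorem isHyperbolicPair_zmodHom {K : Type*} [CommGroup K] [TopologicalSpace K]
    {e : K → K → Circle} (he : IsAlternatingBicharacter e) {n : ℕ} [NeZero n] {x y : K}
    (hx : x ^ n = 1) (hy : y ^ n = 1) (hxy : e x y = ZMod.toCircle (1 : ZMod n)) :
    IsHyperbolicPair e (zmodDualPair n) (zmodHom x hx) (zmodHom y hy) where
  apply_left_right a b := by
    change _ = ZMod.toCircle (a.toAdd * b.toAdd)
    rw [zmodHom_apply, zmodHom_apply, he.pow_left, he.pow_right, hxy, ← pow_mul,
      ← AddChar.map_nsmul_eq_pow, nsmul_one, Nat.cast_mul, ZMod.natCast_zmod_val,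
      ZMod.natCast_zmod_val, mul_comm]
  isotropic_left a b := by
    rw [zmodHom_apply, zmodHom_apply, he.pow_left, he.pow_right, he.alternating, one_pow, one_pow]
  isotropic_right a b := by
    rw [zmodHom_apply, zmodHom_apply, he.pow_left, he.pow_right, he.alternating, one_pow, one_pow]

/-- An element of maximal order has a partner with which it spans a hyperbolic plane. -/
theorem exists_isHyperbolicPair_zmod {K : Type*} [CommGroup K] [TopologicalSpace K] [Finite K]
    [Nontrivial K] {e : K → K → Circle} (he : IsAlternatingBicharacter e)
    (hn : IsNondegenerateBicharacter e) :
    ∃ (n : ℕ) (_ : NeZero n) (α β : Multiplicative (ZMod n) →ₜ* K) (x : K), x ≠ 1 ∧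
      x ∈ Set.range α ∧ IsHyperbolicPair e (zmodDualPair n) α β := by
  obtain ⟨x, hx⟩ := Monoid.exists_orderOf_eq_exponent (G := K) Monoid.ExponentExists.of_finite
  have : NeZero (Monoid.exponent K) := ⟨Monoid.exponent_ne_zero_of_finite⟩
  obtain ⟨y, hy⟩ := he.exists_apply_eq_toCircle hn hx
  refine ⟨Monoid.exponent K, this, _, _, x, fun h => ?_, ⟨_, zmodHom_natCast_one _⟩,
    isHyperbolicPair_zmodHom he (Monoid.pow_exponent_eq_one x) (Monoid.pow_exponent_eq_one y) hy⟩
  rw [h, orderOf_one] at hx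
  exact not_subsingleton K (Monoid.exp_eq_one_iff.1 hx.symm)

theorem hasPolarization_of_finite (m : ℕ) : ∀ (K : Type u) [CommGroup K] [TopologicalSpace K]
    [IsTopologicalGroup K] [Finite K] (e : K → K → Circle), IsAlternatingBicharacter e →
    IsNondegenerateBicharacter e → Nat.card K = m → HasPolarization.{u, v} e := by
  induction m using Nat.strong_induction_on with
  | _ m ih =>
  rintro K _ _ _ _ e he hn rfl
  rcases subsingleton_or_nontrivial K with _ | _
  · exact hasPolarization_of_subsingleton he
  obtain ⟨n, _, α, β, _, hx, ⟨a, rfl⟩, h⟩ := exists_isHyperbolicPair_zmod he hn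
  refine h.hasPolarization_of_complement he hn (.of_discreteTopology _) (hasLifts_zmod n)
    (hasLifts_zmod n) (ih _ ?_ _ _ (he.restrict _) (h.isNondegenerateBicharacter_complement he hn)
      rfl)
  cases nonempty_fintype K
  have : Fintype (h.complement hn) := Fintype.ofFinite _
  rw [Nat.card_eq_fintype_card, Nat.card_eq_fintype_card]
  refine Fintype.card_lt_of_surjective_not_injective _ (h.surjective_retraction he hn)
    fun hinj => hx (hinj ?_)
  rw [h.retraction_left, map_one]

end Finite

namespace IsNondegenerateBicharacter

variable {K : Type*} [CommGroup K] [TopologicalSpace K] {e : K → K → Circle}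

theorem finite_of_discreteTopology [DiscreteTopology K] (hn : IsNondegenerateBicharacter e) :
    Finite K := by
  have : CompactSpace K := hn.flat.symm.toHomeomorph.compactSpace
  exact finite_of_compact_of_discrete

/-- The annihilator of `H` corresponds to the dual of the discrete group `K ⧸ H`. -/
theorem isCompact_annihilator [IsTopologicalGroup K] (hn : IsNondegenerateBicharacter e)
    {H : Subgroup K} (hH : IsOpen (H : Set K)) : IsCompact {k | ∀ h ∈ H, e h k = 1} := by
  have : DiscreteTopology (K ⧸ H) := QuotientGroup.discreteTopology hH
  let q : K →ₜ* K ⧸ H := ⟨QuotientGroup.mk' H, continuous_quot_mk⟩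
  have heq : {k | ∀ h ∈ H, e h k = 1} = hn.flat.symm '' Set.range (PontryaginDual.map q) := by
    ext k
    constructor
    · intro hk
      let χ : (K ⧸ H) →ₜ* Circle :=
        ⟨QuotientGroup.lift H (MonoidHom.mk' (hn.flat k) fun a b => map_mul _ a b)
          fun h hh => (hn.flat_apply h k).trans (hk h hh), continuous_of_discreteTopology⟩
      exact ⟨hn.flat k, ⟨χ, PontryaginDual.ext fun _ => rfl⟩, hn.flat.symm_apply_apply k⟩
    · rintro ⟨_, ⟨χ, rfl⟩, rfl⟩ h hh
      rw [hn.apply_flat_symm, PontryaginDual.map_apply,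
        show q h = 1 from (QuotientGroup.eq_one_iff h).2 hh, map_one]
  rw [heq]
  exact (isCompact_range (map_continuous _)).image (map_continuous hn.flat.symm)

end IsNondegenerateBicharacter

section Logarithm

/-- `f v` is divisible by all positive integers. -/
theorem eq_zero_of_forall_exists_int {V : Type*} [AddCommGroup V] [Module ℝ V] (f : V →+ ℝ)
    (hf : ∀ v, ∃ m : ℤ, f v = m) (v : V) : f v = 0 := by
  obtain ⟨m, hm⟩ := hf v
  have hdvd (n : ℕ) (hn : n ≠ 0) : (n : ℤ) ∣ m := by
    obtain ⟨m', hm'⟩ := hf ((n : ℝ)⁻¹ • v)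
    refine ⟨m', ?_⟩
    have hv : v = n • (n : ℝ)⁻¹ • v := by
      rw [← Nat.cast_smul_eq_nsmul ℝ, smul_smul, mul_inv_cancel₀ (Nat.cast_ne_zero.2 hn), one_smul]
    have hreal : (m : ℝ) = n * m' := by
      rw [← hm, ← hm', ← nsmul_eq_mul, ← map_nsmul, ← hv]
    exact_mod_cast hreal
  have hm0 : m = 0 :=
    Int.eq_zero_of_dvd_of_natAbs_lt_natAbs (hdvd (m.natAbs + 1) (by omega)) (by omega)
  rw [hm, hm0, Int.cast_zero]

theorem exists_int_of_circle_exp_two_pi_mul_eq_one {t : ℝ}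
    (h : Circle.exp (2 * Real.pi * t) = 1) : ∃ m : ℤ, t = m := by
  obtain ⟨m, hm⟩ := Circle.exp_eq_one.1 h
  exact ⟨m, mul_left_cancel₀ (by positivity) (hm.trans (mul_comm _ _))⟩

variable {V : Type*} [NormedAddCommGroup V] [NormedSpace ℝ V]

theorem linear_eq_of_circle_exp_eq {l l' : V →L[ℝ] ℝ}
    (h : ∀ v, Circle.exp (2 * Real.pi * l v) = Circle.exp (2 * Real.pi * l' v)) : l = l' := by
  ext v
  let difference : V →+ ℝ := (l - l').toLinearMap.toAddMonoidHom
  refine sub_eq_zero.1 (eq_zero_of_forall_exists_int difference (fun w => ?_) v)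
  apply exists_int_of_circle_exp_two_pi_mul_eq_one
  change Circle.exp (2 * Real.pi * (l w - l' w)) = 1
  rw [mul_sub, Circle.exp_sub, h, div_self']

namespace IsAlternatingBicharacter

variable {K : Type*} [CommGroup K] [TopologicalSpace K] {e : K → K → Circle}
  (he : IsAlternatingBicharacter e) (hn : IsNondegenerateBicharacter e)
  (E : Multiplicative V →ₜ* K)

include he hn in
theorem exists_log (k : K) :
    ∃ l : V →L[ℝ] ℝ, ∀ v, e (E (.ofAdd v)) k = Circle.exp (2 * Real.pi * l v) := by
  refine exists_linear_of_character ?_ fun v w => by rw [ofAdd_add, map_mul, he.mul_left]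
  simp only [← hn.flat_apply]
  exact (map_continuous (hn.flat k)).comp ((map_continuous E).comp continuous_ofAdd)

/-- The logarithm of the character `v ↦ e (E v, k)` of `V`, divided by `2πi`. -/
noncomputable def log : Additive K →+ (V →L[ℝ] ℝ) :=
  AddMonoidHom.mk' (fun k => (he.exists_log hn E k.toMul).choose) fun k k' =>
    linear_eq_of_circle_exp_eq fun v => by
      rw [← (he.exists_log hn E _).choose_spec, toMul_add, he.mul_right,
        (he.exists_log hn E _).choose_spec, (he.exists_log hn E _).choose_spec,
        add_apply, mul_add, Circle.exp_add]

theorem circle_exp_log (k : K) (v : V) :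
    Circle.exp (2 * Real.pi * he.log hn E (.ofMul k) v) = e (E (.ofAdd v)) k :=
  ((he.exists_log hn E k).choose_spec v).symm

theorem log_antisymm (v w : V) :
    he.log hn E (.ofMul (E (.ofAdd w))) v = -he.log hn E (.ofMul (E (.ofAdd v))) w := by
  let symmetrization : V →+ ℝ := AddMonoidHom.mk'
    (fun w => he.log hn E (.ofMul (E (.ofAdd w))) v + he.log hn E (.ofMul (E (.ofAdd v))) w)
    fun w w' => by
      rw [ofAdd_add, map_mul, ofMul_mul, map_add, map_add, add_apply,
        add_add_add_comm]
  refine eq_neg_of_add_eq_zero_left (eq_zero_of_forall_exists_int symmetrization (fun w => ?_) w)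
  apply exists_int_of_circle_exp_two_pi_mul_eq_one
  change Circle.exp (2 * Real.pi * (_ + _)) = 1
  rw [mul_add, Circle.exp_add, he.circle_exp_log, he.circle_exp_log, he.swap, inv_mul_cancel]

theorem log_self (v : V) : he.log hn E (.ofMul (E (.ofAdd v))) v = 0 :=
  self_eq_neg.1 (he.log_antisymm hn E v v)

theorem log_smul_smul (s t : ℝ) (v w : V) :
    he.log hn E (.ofMul (E (.ofAdd (t • w)))) (s • v) =
      s * t * he.log hn E (.ofMul (E (.ofAdd w))) v := by
  rw [map_smul, he.log_antisymm, map_smul, ← smul_neg, ← he.log_antisymm, smul_eq_mul, smul_eq_mul,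
    mul_assoc]

end IsAlternatingBicharacter

end Logarithm

section Euclidean

variable {K : Type*} [CommGroup K] [TopologicalSpace K] {V : Type*} [NormedAddCommGroup V]
  [NormedSpace ℝ V]

/-- The one-parameter subgroup of `K` in the direction of a vector. -/
noncomputable def rayHom (E : Multiplicative V →ₜ* K) (v : V) : Multiplicative ℝ →ₜ* K :=
  ⟨MonoidHom.mk' (fun t => E (.ofAdd (t.toAdd • v))) fun s t => by
    rw [toAdd_mul, add_smul, ofAdd_add, map_mul], (map_continuous E).comp
      (continuous_ofAdd.comp (continuous_toAdd.smul continuous_const))⟩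

theorem rayHom_apply (E : Multiplicative V →ₜ* K) (v : V) (t : Multiplicative ℝ) :
    rayHom E v t = E (.ofAdd (t.toAdd • v)) := rfl

theorem isHyperbolicPair_rayHom {e : K → K → Circle} (he : IsAlternatingBicharacter e)
    (hn : IsNondegenerateBicharacter e) (E : Multiplicative V →ₜ* K) {v w : V}
    (hvw : he.log hn E (.ofMul (E (.ofAdd w))) v = 1) :
    IsHyperbolicPair e realDualPair (rayHom E v) (rayHom E w) where
  apply_left_right s t := by
    change _ = Circle.exp (2 * Real.pi * (s.toAdd * t.toAdd))
    rw [rayHom_apply, rayHom_apply, ← he.circle_exp_log hn, he.log_smul_smul, hvw, mul_one]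
  isotropic_left s t := by
    rw [rayHom_apply, rayHom_apply, ← he.circle_exp_log hn, he.log_smul_smul, he.log_self,
      mul_zero, mul_zero, Circle.exp_zero]
  isotropic_right s t := by
    rw [rayHom_apply, rayHom_apply, ← he.circle_exp_log hn, he.log_smul_smul, he.log_self,
      mul_zero, mul_zero, Circle.exp_zero]

end Euclidean

section IntegralVector

variable {V : Type*} [NormedAddCommGroup V] [NormedSpace ℝ V]

theorem exists_apply_eq_one_forall_apply_eq_zero {ι : Type*} [Finite ι] {c : ι → V →L[ℝ] ℝ}
    (hc : LinearIndependent ℝ c) (i : ι) : ∃ v, c i v = 1 ∧ ∀ j ≠ i, c j v = 0 := by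
  obtain ⟨v, hv0, hvi⟩ : ∃ v, (∀ j ≠ i, c j v = 0) ∧ c i v ≠ 0 := by
    by_contra! h
    have hmem : (c i : V →ₗ[ℝ] ℝ) ∈ Submodule.span ℝ
        (Set.range fun j : {j // j ≠ i} => (c j : V →ₗ[ℝ] ℝ)) := by
      refine mem_span_of_iInf_ker_le_ker fun v hv => ?_
      simp only [Submodule.mem_iInf, LinearMap.mem_ker] at hv ⊢
      exact h v fun j hj => hv ⟨j, hj⟩
    have hli : LinearIndependent ℝ fun j => (c j : V →ₗ[ℝ] ℝ) :=
      hc.map' (ContinuousLinearMap.coeLM ℝ)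
        (LinearMap.ker_eq_bot.2 ContinuousLinearMap.coe_injective)
    refine hli.notMem_span_image (s := {j | j ≠ i}) (x := i) (not_not.2 rfl) ?_
    rwa [Set.image_eq_range]
  refine ⟨(c i v)⁻¹ • v, by rw [map_smul, smul_eq_mul, inv_mul_cancel₀ hvi], fun j hj => ?_⟩
  rw [map_smul, hv0 j hj, smul_zero]

/-- The vector is taken from the dual of a `ℤ`-basis of `M`. -/
theorem exists_integral_vector [FiniteDimensional ℝ V] (M : Submodule ℤ (V →L[ℝ] ℝ))
    [DiscreteTopology M] (hM : M ≠ ⊥) :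
    ∃ (v : V), ∃ l ∈ M, l v = 1 ∧ ∀ l' ∈ M, ∃ m : ℤ, l' v = m := by
  let b := Module.Free.chooseBasis ℤ M
  let c := fun i => (b i : V →L[ℝ] ℝ)
  have hspan : Submodule.span ℤ (Set.range c) = M := by
    have hrange : Set.range c = M.subtype '' Set.range b := (Set.range_comp _ _)
    rw [hrange, ← Submodule.map_span, b.span_eq, Submodule.map_top, Submodule.range_subtype]
  have hc : LinearIndependent ℝ c := by
    rw [linearIndependent_iff_card_eq_finrank_span,
      Real.finrank_eq_int_finrank_of_discrete (by rw [hspan]; infer_instance), Set.finrank, hspan,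
      Module.finrank_eq_card_basis b]
  obtain ⟨i⟩ : Nonempty (Module.Free.ChooseBasisIndex ℤ M) := by
    by_contra h
    rw [not_nonempty_iff] at h
    rw [Set.range_eq_empty, Submodule.span_empty] at hspan
    exact hM hspan.symm
  obtain ⟨v, hvi, hv⟩ := exists_apply_eq_one_forall_apply_eq_zero hc i
  refine ⟨v, c i, (b i).2, hvi, fun l hl => ?_⟩
  rw [← hspan] at hl
  induction hl using Submodule.span_induction with
  | mem _ hx =>
    obtain ⟨j, rfl⟩ := hx
    by_cases hj : j = i
    · exact ⟨1, by rw [hj, hvi, Int.cast_one]⟩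
    · exact ⟨0, by rw [hv j hj, Int.cast_zero]⟩
  | zero => exact ⟨0, by rw [zero_apply, Int.cast_zero]⟩
  | add x y _ _ hx hy =>
    obtain ⟨m, hm⟩ := hx
    obtain ⟨m', hm'⟩ := hy
    exact ⟨m + m', by rw [add_apply, hm, hm', Int.cast_add]⟩
  | smul a x _ hx =>
    obtain ⟨m, hm⟩ := hx
    exact ⟨a * m, by rw [smul_apply, hm, zsmul_eq_mul, Int.cast_mul]⟩

end IntegralVector

section Isotropic

variable {V : Type*} [NormedAddCommGroup V]

theorem exists_bounded_preimage_of_isCompact_range {X : Type*} [TopologicalSpace X] {f : V → X}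
    (ho : IsOpenMap f) (hc : IsCompact (Set.range f)) :
    ∃ R, 0 < R ∧ ∀ v, ∃ w, ‖w‖ ≤ R ∧ f w = f v := by
  obtain ⟨N, hN⟩ := hc.elim_directed_cover (fun N : ℕ => f '' Metric.ball 0 N)
    (fun N => ho _ Metric.isOpen_ball)
    (by
      rintro _ ⟨v, rfl⟩
      obtain ⟨N, hN⟩ := exists_nat_gt ‖v‖
      exact Set.mem_iUnion.2 ⟨N, v, mem_ball_zero_iff.2 hN, rfl⟩)
    (directed_of_isDirected_le fun a b hab =>
      Set.image_mono (Metric.ball_subset_ball (Nat.cast_le.2 hab)))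
  refine ⟨N + 1, by positivity, fun v => ?_⟩
  obtain ⟨w, hw, hwv⟩ := hN ⟨v, rfl⟩
  exact ⟨w, (mem_ball_zero_iff.1 hw).le.trans (by linarith), hwv⟩

theorem isCompact_range_of_isotropic {K : Type*} [CommGroup K] [TopologicalSpace K]
    [IsTopologicalGroup K] {e : K → K → Circle} (hn : IsNondegenerateBicharacter e)
    {E : Multiplicative V →ₜ* K} (hE : ∀ v w, e (E v) (E w) = 1) (ho : IsOpenMap E) :
    IsCompact (Set.range E) := by
  have hopen : IsOpen (E.toMonoidHom.range : Set K) := ho.isOpen_range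
  refine (hn.isCompact_annihilator hopen).of_isClosed_subset
    (Subgroup.isClosed_of_isOpen _ hopen) ?_
  rintro _ ⟨v, rfl⟩ _ ⟨w, rfl⟩
  exact hE w v

variable [NormedSpace ℝ V] {K : Type*} [CommGroup K] [TopologicalSpace K] {e : K → K → Circle}
  (he : IsAlternatingBicharacter e) (hn : IsNondegenerateBicharacter e)
  {E : Multiplicative V →ₜ* K}

/-- The logarithms of all elements of `K`, as a `ℤ`-submodule of the dual of `V`. -/
noncomputable def logModule (E : Multiplicative V →ₜ* K) : Submodule ℤ (V →L[ℝ] ℝ) :=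
  (he.log hn E).range.toIntSubmodule

theorem log_mem_logModule (k : K) : he.log hn E (.ofMul k) ∈ logModule he hn E := ⟨.ofMul k, rfl⟩

/-- If `‖log k‖ < 1 / (4 R)`, then `log k` takes values in `(-1/4, 1/4)` modulo `1`, hence does not
take the value `1/2`. -/
theorem discreteTopology_logModule {R : ℝ} (hR : 0 < R)
    (hER : ∀ v, ∃ w, ‖w‖ ≤ R ∧ E (.ofAdd w) = E (.ofAdd v)) :
    DiscreteTopology (logModule he hn E) := by
  refine DiscreteTopology.of_forall_le_dist (r := 1 / (4 * R)) (by positivity) fun x y hxy => ?_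
  by_contra! hlt
  obtain ⟨k, hk⟩ := (logModule he hn E).sub_mem x.2 y.2
  set l := he.log hn E k
  have hl : ‖l‖ < 1 / (4 * R) := by
    rw [hk]
    exact (dist_eq_norm (x : V →L[ℝ] ℝ) y).symm.trans_lt hlt
  obtain ⟨v, hv⟩ : ∃ v, l v ≠ 0 := by
    by_contra! h
    exact hxy (Subtype.ext (sub_eq_zero.1 (hk.symm.trans (ContinuousLinearMap.ext h))))
  obtain ⟨w, hw, hEw⟩ := hER ((2 * l v)⁻¹ • v)
  obtain ⟨m, hm⟩ : ∃ m : ℤ, l ((2 * l v)⁻¹ • v) - l w = m := by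
    apply exists_int_of_circle_exp_two_pi_mul_eq_one
    rw [mul_sub, Circle.exp_sub, div_eq_one]
    change Circle.exp (2 * Real.pi * he.log hn E (.ofMul k.toMul) _) =
      Circle.exp (2 * Real.pi * he.log hn E (.ofMul k.toMul) _)
    rw [he.circle_exp_log, he.circle_exp_log, hEw]
  have hhalf : l ((2 * l v)⁻¹ • v) = 1 / 2 := by
    rw [map_smul, smul_eq_mul]
    field_simp
  have hquarter : |l w| ≤ 1 / 4 :=
    calc |l w| ≤ ‖l‖ * ‖w‖ := l.le_opNorm w
      _ ≤ 1 / (4 * R) * R := by gcongr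
      _ = 1 / 4 := by field_simp
  rw [abs_le] at hquarter
  have hm0 : (0 : ℝ) < m := by linarith
  have hm1 : (m : ℝ) < 1 := by linarith
  have : 0 < m := by exact_mod_cast hm0
  have : m < 1 := by exact_mod_cast hm1
  omega

theorem eq_one_of_forall_log_integral {v : V}
    (hv : ∀ l ∈ logModule he hn E, ∃ m : ℤ, l v = m) : E (.ofAdd v) = 1 := by
  refine he.eq_one_of_forall_apply_eq_one hn fun k => ?_
  obtain ⟨m, hm⟩ := hv _ (log_mem_logModule he hn k)
  rw [← he.circle_exp_log hn, hm]
  exact Circle.exp_eq_one.2 ⟨m, mul_comm _ _⟩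

theorem exists_isHyperbolicPair_int_circle (hE : ∀ v w, e (E v) (E w) = 1) {k : K} {v : V}
    (hkv : he.log hn E (.ofMul k) v = 1) (hv : ∀ l ∈ logModule he hn E, ∃ m : ℤ, l v = m) :
    ∃ α β, IsHyperbolicPair e intCircleDualPair α β ∧
      ∀ t : ℝ, E (.ofAdd (t • v)) ∈ Set.range β := by
  have hpi : 2 * Real.pi ≠ 0 := by positivity
  obtain ⟨β, hβ⟩ := exists_circle_hom_exp (rayHom E ((2 * Real.pi)⁻¹ • v)) <| by
    rw [rayHom_apply, toAdd_ofAdd, smul_smul, mul_inv_cancel₀ hpi, one_smul,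
      eq_one_of_forall_log_integral he hn hv]
  have hβ' (t : ℝ) : β (Circle.exp (2 * Real.pi * t)) = E (.ofAdd (t • v)) := by
    rw [hβ, rayHom_apply, toAdd_ofAdd, smul_smul, mul_right_comm, mul_inv_cancel₀ hpi, one_mul]
  have surjective_exp (z : Circle) : ∃ t, Circle.exp (2 * Real.pi * t) = z := by
    obtain ⟨t, rfl⟩ := Circle.exp_surjective z
    exact ⟨t / (2 * Real.pi), by rw [mul_div_cancel₀ _ hpi]⟩
  let α : Multiplicative ℤ →ₜ* K := ⟨zpowersHom K k⁻¹, continuous_of_discreteTopology⟩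
  have hα (n : Multiplicative ℤ) : α n = k⁻¹ ^ n.toAdd := rfl
  refine ⟨α, β, ⟨fun n z => ?_, fun n n' => ?_, fun z z' => ?_⟩, fun t => ⟨_, hβ' t⟩⟩
  · change _ = z ^ n.toAdd
    obtain ⟨t, rfl⟩ := surjective_exp z
    rw [hα, hβ', he.zpow_left, he.inv_left, ← he.swap, ← he.circle_exp_log hn, map_smul, hkv,
      smul_eq_mul, mul_one]
  · rw [hα, hα, he.zpow_left, he.zpow_right, he.alternating, one_zpow, one_zpow]
  · obtain ⟨t, rfl⟩ := surjective_exp z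
    obtain ⟨s, rfl⟩ := surjective_exp z'
    rw [hβ', hβ', hE]

end Isotropic

section Induction

/-- Some hyperbolic pair of groups that are elementary and have lifts contains the image of a
line. -/
def SplitsLine {K : Type u} [CommGroup K] [TopologicalSpace K] (e : K → K → Circle) {V : Type}
    [NormedAddCommGroup V] [NormedSpace ℝ V] (E : Multiplicative V →ₜ* K) : Prop :=
  ∃ (A B : Type) (_ : CommGroup A) (_ : TopologicalSpace A) (_ : CommGroup B)
    (_ : TopologicalSpace B) (p : DualPair A B) (α : A →ₜ* K) (β : B →ₜ* K),
    IsHyperbolicPair e p α β ∧ IsEuclideanTimesDiscrete A ∧ HasLifts.{u, v} A ∧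
    HasLifts.{u, v} B ∧
    ∃ v ≠ 0, ∀ t : ℝ, E (.ofAdd (t • v)) ∈ Set.range α ∪ Set.range β

variable {K : Type u} [CommGroup K] [TopologicalSpace K] {V : Type}
  [NormedAddCommGroup V] [NormedSpace ℝ V] [FiniteDimensional ℝ V] {e : K → K → Circle}

theorem splitsLine_or_discreteTopology_of_isotropic [IsTopologicalGroup K]
    (he : IsAlternatingBicharacter e) (hn : IsNondegenerateBicharacter e)
    {E : Multiplicative V →ₜ* K} (ho : IsOpenMap E)
    (hE : ∀ v w, e (E v) (E w) = 1) : SplitsLine.{u, v} e E ∨ DiscreteTopology K := by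
  obtain ⟨R, hR, hER⟩ :=
    exists_bounded_preimage_of_isCompact_range (V := V) (f := fun v => E (.ofAdd v)) ho
      (isCompact_range_of_isotropic hn hE ho)
  have := discreteTopology_logModule he hn hR hER
  by_cases hM : logModule he hn E = ⊥
  · right
    have hE1 (v : V) : E (.ofAdd v) = 1 := eq_one_of_forall_log_integral he hn fun l hl => by
      rw [hM, Submodule.mem_bot] at hl
      exact ⟨0, by rw [hl, zero_apply, Int.cast_zero]⟩
    refine discreteTopology_of_isOpen_singleton_one ?_
    convert ho.isOpen_range
    exact (Set.range_eq_singleton_iff.2 hE1).symm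
  · left
    obtain ⟨v, _, ⟨k, rfl⟩, hkv, hintegral⟩ := exists_integral_vector _ hM
    obtain ⟨α, β, h, hβ⟩ := exists_isHyperbolicPair_int_circle he hn hE (k := k.toMul) hkv hintegral
    refine ⟨_, _, _, _, _, _, _, α, β, h, .of_discreteTopology _, hasLifts_int, hasLifts_circle, v,
      ?_, fun t => .inr (hβ t)⟩
    rintro rfl
    exact zero_ne_one ((map_zero _).symm.trans hkv)

theorem splitsLine_or_discreteTopology [IsTopologicalGroup K]
    (he : IsAlternatingBicharacter e) (hn : IsNondegenerateBicharacter e)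
    {E : Multiplicative V →ₜ* K} (ho : IsOpenMap E) :
    SplitsLine.{u, v} e E ∨ DiscreteTopology K := by
  by_cases hω : ∀ v w, he.log hn E (.ofMul (E (.ofAdd w))) v = 0
  · refine splitsLine_or_discreteTopology_of_isotropic he hn ho fun v w => ?_
    rw [← ofAdd_toAdd v, ← he.circle_exp_log hn]
    exact (congrArg Circle.exp (mul_eq_zero_of_right _ (hω v.toAdd w.toAdd))).trans Circle.exp_zero
  · push Not at hω
    obtain ⟨v', w, hv'⟩ := hω
    obtain ⟨v, hv⟩ : ∃ v, he.log hn E (.ofMul (E (.ofAdd w))) v = 1 :=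
      ⟨(he.log hn E (.ofMul (E (.ofAdd w))) v')⁻¹ • v', by
        rw [map_smul, smul_eq_mul, inv_mul_cancel₀ hv']⟩
    refine .inl ⟨_, _, _, _, _, _, _, _, _, isHyperbolicPair_rayHom he hn E hv, .real,
      hasLifts_real, hasLifts_real, v, ?_, fun t => .inl ⟨.ofAdd t, rfl⟩⟩
    rintro rfl
    exact zero_ne_one ((map_zero _).symm.trans hv)

theorem exists_isOpenMap_of_line_le_ker {E : Multiplicative V →ₜ* K} (ho : IsOpenMap E)
    {v : V} (hv0 : v ≠ 0) (hv : ∀ t : ℝ, E (.ofAdd (t • v)) = 1) :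
    ∃ (W : Submodule ℝ V) (E' : Multiplicative W →ₜ* K), IsOpenMap E' ∧
      Module.finrank ℝ W < Module.finrank ℝ V := by
  obtain ⟨W, hW⟩ := Submodule.exists_isCompl (ℝ ∙ v)
  let p : V →ₗ[ℝ] W := W.projectionOnto (ℝ ∙ v) hW.symm
  have hp : Continuous p := p.continuous_of_finiteDimensional
  have hpW (w : W) : p w = w := Submodule.projectionOnto_apply_left hW.symm w
  have hEp (x : V) : E (.ofAdd (p x)) = E (.ofAdd x) := by
    have hx : x - p x ∈ ℝ ∙ v := by
      rw [← Submodule.projectionOnto_apply_eq_zero_iff hW.symm, map_sub, hpW, sub_self]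
    obtain ⟨t, ht⟩ := Submodule.mem_span_singleton.1 hx
    conv_rhs => rw [← sub_add_cancel x (p x), ofAdd_add, map_mul, ← ht, hv, one_mul]
  let E' : Multiplicative W →ₜ* K :=
    ⟨MonoidHom.mk' (fun w => E (.ofAdd (w.toAdd : V))) fun w w' => by
      rw [toAdd_mul, Submodule.coe_add, ofAdd_add, map_mul],
      (map_continuous E).comp
        (continuous_ofAdd.comp (continuous_subtype_val.comp continuous_toAdd))⟩
  refine ⟨W, E', fun U hU => ?_, ?_⟩
  · have himage : E' '' U = E '' ((fun x => .ofAdd (p x.toAdd)) ⁻¹' U) := by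
      ext k
      constructor
      · rintro ⟨w, hw, rfl⟩
        refine ⟨.ofAdd w.toAdd, ?_, rfl⟩
        rwa [Set.mem_preimage, toAdd_ofAdd, hpW]
      · rintro ⟨x, hx, rfl⟩
        exact ⟨_, hx, hEp x⟩
    rw [himage]
    exact ho _ (hU.preimage (continuous_ofAdd.comp (hp.comp continuous_toAdd)))
  · have hrank := Submodule.finrank_add_eq_of_isCompl hW
    rw [finrank_span_singleton hv0] at hrank
    omega

end Induction

theorem hasPolarization_of_isOpenMap (n : ℕ) : ∀ (K : Type u) [CommGroup K] [TopologicalSpace K]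
    [IsTopologicalGroup K] (e : K → K → Circle), IsAlternatingBicharacter e →
    IsNondegenerateBicharacter e → ∀ (V : Type) [NormedAddCommGroup V] [NormedSpace ℝ V]
    [FiniteDimensional ℝ V] (E : Multiplicative V →ₜ* K), IsOpenMap E →
    Module.finrank ℝ V = n → HasPolarization.{u, v} e := by
  induction n using Nat.strong_induction_on with
  | _ n ih =>
  rintro K _ _ _ e he hn V _ _ _ E ho rfl
  rcases splitsLine_or_discreteTopology.{u, v} he hn ho with hsplit | _
  · obtain ⟨A, B, _, _, _, _, p, α, β, h, hA, hlA, hlB, v, hv0, hv⟩ := hsplit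
    have hkills (t : ℝ) : h.retraction he hn (E (.ofAdd (t • v))) = 1 := by
      rcases hv t with ⟨a, ha⟩ | ⟨b, hb⟩
      · rw [← ha, h.retraction_left]
      · rw [← hb, h.retraction_right]
    obtain ⟨W, E', ho', hW⟩ := exists_isOpenMap_of_line_le_ker
      (E := (h.retraction he hn).comp E) ((h.isOpenMap_retraction he hn).comp ho) hv0 hkills
    exact h.hasPolarization_of_complement he hn hA hlA hlB (ih _ hW _ _ (he.restrict _)
      (h.isNondegenerateBicharacter_complement he hn) W E' ho' rfl)
  · have := hn.finite_of_discreteTopology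
    exact hasPolarization_of_finite _ K e he hn rfl

theorem IsLieGroup.hasPolarization {K : Type u} [CommGroup K] [TopologicalSpace K]
    (hK : IsLieGroup K) {e : K → K → Circle} (he : IsAlternatingBicharacter e)
    (hn : IsNondegenerateBicharacter e) : HasPolarization.{u, v} e := by
  have := hK.isTopologicalGroup
  obtain ⟨n, E, hE⟩ := hK.exists_exponential
  exact hasPolarization_of_isOpenMap _ K e he hn _ E hE rfl

section LieGroup

open Topology Set

variable {X D A : Type*} [NormedAddCommGroup X] [NormedSpace ℝ X]
  [CommGroup D] [TopologicalSpace D] [DiscreteTopology D] [CommGroup A] [TopologicalSpace A]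

/-- The coordinates on the open sheet `X × {d}` of a group `A ≅ X × D` with `D` discrete. -/
def sheetChart (f : A ≃ₜ* Multiplicative X × D) (d : D) : OpenPartialHomeomorph A X where
  toFun a := (f a).1.toAdd
  invFun x := f.symm (Multiplicative.ofAdd x, d)
  source := {a | (f a).2 = d}
  target := univ
  map_source' _ _ := mem_univ _
  map_target' x _ := by simp
  left_inv' := by
    rintro a rfl
    simp
  right_inv' x _ := by simp
  open_source := (isOpen_discrete {d}).preimage (map_continuous f).snd
  open_target := isOpen_univ
  continuousOn_toFun := (continuous_toAdd.comp (map_continuous f).fst).continuousOn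
  continuousOn_invFun := ((map_continuous f.symm).comp
    (continuous_ofAdd.prodMk continuous_const)).continuousOn

/-- The charted space structure on `A ≅ X × D`, for `D` discrete, with one chart per sheet. -/
abbrev sheetChartedSpace (f : A ≃ₜ* Multiplicative X × D) : ChartedSpace X A where
  atlas := range (sheetChart f)
  chartAt a := sheetChart f (f a).2
  mem_chart_source _ := rfl
  chart_mem_atlas _ := ⟨_, rfl⟩

theorem exists_lieGroup_of_continuousMulEquiv (f : A ≃ₜ* Multiplicative X × D) :
    ∃ _ : ChartedSpace X A, LieGroup 𝓘(ℝ, X) ∞ A := by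
  have := f.isInducing.topologicalGroup f
  let _ := sheetChartedSpace f
  have : IsManifold 𝓘(ℝ, X) ∞ A := by
    refine isManifold_of_contDiffOn _ _ _ ?_
    rintro _ _ ⟨d, rfl⟩ ⟨d', rfl⟩
    exact contDiffOn_id.congr fun x _ => (sheetChart f d).right_inv (mem_univ x)
  let φ : A → X := fun a => (f a).1.toAdd
  have extChartAt_eq (a : A) : (extChartAt 𝓘(ℝ, X) a : A → X) = φ := rfl
  have contMDiff_φ : ContMDiff 𝓘(ℝ, X) 𝓘(ℝ, X) ∞ φ := fun a =>
    contMDiffAt_extChartAt (I := 𝓘(ℝ, X)) (n := ∞) (x := a)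
  have mul_φ : (φ ∘ fun p : A × A => p.1 * p.2) = fun p => φ p.1 + φ p.2 := by
    funext p
    simp [φ]
  have inv_φ : (φ ∘ fun a : A => a⁻¹) = fun a => -φ a := by
    funext a
    simp [φ]
  refine ⟨inferInstance, { contMDiff_mul := fun p => ?_, contMDiff_inv := fun a => ?_ }⟩
  · rw [contMDiffAt_iff_target, extChartAt_eq, mul_φ]
    exact ⟨continuous_mul.continuousAt,
      ((contMDiff_φ.comp contMDiff_fst).add (contMDiff_φ.comp contMDiff_snd)) p⟩
  · rw [contMDiffAt_iff_target, extChartAt_eq, inv_φ]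
    exact ⟨continuous_inv.continuousAt, contMDiff_φ.neg a⟩

end LieGroup

namespace IsEuclideanTimesDiscrete

open Topology Set

variable {A : Type} [CommGroup A] [TopologicalSpace A]

theorem isTopologicalGroup (hA : IsEuclideanTimesDiscrete A) : IsTopologicalGroup A := by
  obtain ⟨V, _, _, _, D, _, _, _, _, ⟨f⟩⟩ := hA
  exact f.isInducing.topologicalGroup f

theorem t2Space (hA : IsEuclideanTimesDiscrete A) : T2Space A := by
  obtain ⟨V, _, _, _, D, _, _, _, _, ⟨f⟩⟩ := hA
  exact T2Space.of_injective_continuous f.injective (map_continuous f)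

theorem locallyCompactSpace (hA : IsEuclideanTimesDiscrete A) : LocallyCompactSpace A := by
  obtain ⟨V, _, _, _, D, _, _, _, _, ⟨f⟩⟩ := hA
  have : LocallyCompactSpace (Multiplicative V) := inferInstanceAs (LocallyCompactSpace V)
  exact f.toHomeomorph.isClosedEmbedding.locallyCompactSpace

theorem t4Space (hA : IsEuclideanTimesDiscrete A) : T4Space A := by
  have := hA.t2Space
  have := hA.locallyCompactSpace
  obtain ⟨V, _, _, _, D, _, _, _, _, ⟨f⟩⟩ := hA
  have : SecondCountableTopology (Multiplicative V) :=
    inferInstanceAs (SecondCountableTopology V)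
  have : SecondCountableTopology A := f.toHomeomorph.secondCountableTopology
  infer_instance

theorem countable_connectedComponents (hA : IsEuclideanTimesDiscrete A) :
    Countable (ConnectedComponents A) := by
  obtain ⟨V, _, _, _, D, _, _, _, _, ⟨f⟩⟩ := hA
  refine Function.Surjective.countable
    (f := fun d : D => (ConnectedComponents.mk (f.symm (1, d)) : ConnectedComponents A)) ?_
  intro c
  obtain ⟨a, rfl⟩ := ConnectedComponents.surjective_coe c
  refine ⟨(f a).2, ConnectedComponents.coe_eq_coe'.2 ?_⟩
  have sheet_preconnected :
      IsPreconnected (range fun v : V => f.symm (Multiplicative.ofAdd v, (f a).2)) :=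
    isPreconnected_range ((map_continuous f.symm).comp
      (continuous_ofAdd.prodMk continuous_const))
  exact sheet_preconnected.subset_connectedComponent
    ⟨(f a).1.toAdd, f.symm_apply_apply a⟩ ⟨0, rfl⟩

theorem isLieGroup (hA : IsEuclideanTimesDiscrete A) : IsLieGroup A := by
  refine ⟨hA.t2Space, hA.countable_connectedComponents, ?_⟩
  obtain ⟨V, _, _, _, D, _, _, _, _, ⟨f⟩⟩ := hA
  let L : V ≃L[ℝ] EuclideanSpace ℝ (Fin (Module.finrank ℝ V)) :=
    ContinuousLinearEquiv.ofFinrankEq (by simp)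
  let toMul : Multiplicative V ≃ₜ* Multiplicative (EuclideanSpace ℝ (Fin (Module.finrank ℝ V))) :=
    { L.toAddEquiv.toMultiplicative with
      continuous_toFun := continuous_ofAdd.comp (L.continuous.comp continuous_toAdd)
      continuous_invFun := continuous_ofAdd.comp (L.symm.continuous.comp continuous_toAdd) }
  exact ⟨_, exists_lieGroup_of_continuousMulEquiv
    (f.trans (prodCongrContinuous toMul (.refl D)))⟩

end IsEuclideanTimesDiscrete

theorem circle_dist_eq_norm_sub (z w : Circle) : dist z w = ‖(z : ℂ) - w‖ :=
  dist_eq_norm (z : ℂ) w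

open Filter Topology in
theorem tendsto_pontryaginDual_iff {A ι : Type*} [CommGroup A] [TopologicalSpace A] {l : Filter ι}
    {F : ι → PontryaginDual A} {χ : PontryaginDual A} :
    Tendsto F l (𝓝 χ) ↔ ∀ C : Set A, IsCompact C →
      TendstoUniformlyOn (fun i y => F i y) (fun y => χ y) l C := by
  have isInducing_toContinuousMap :
      IsInducing (fun χ : PontryaginDual A => (⟨χ, map_continuous χ⟩ : C(A, Circle))) :=
    ContinuousMonoidHom.isInducing_toContinuousMap A Circle
  rw [isInducing_toContinuousMap.tendsto_nhds_iff,
    ContinuousMap.tendsto_iff_forall_isCompact_tendstoUniformlyOn]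
  rfl

namespace Heisenberg

open Filter Topology

variable {A : Type*} [CommGroup A] [TopologicalSpace A] [IsTopologicalGroup A]
  [LocallyCompactSpace A] [MeasurableSpace A] [BorelSpace A]

theorem norm_circle_smul (z : Circle) (f : L2 A) : ‖(z : ℂ) • f‖ = ‖f‖ := by
  rw [norm_smul, Circle.norm_coe, one_mul]

theorem dist_mul_norm (z w : Circle) (f : L2 A) :
    dist z w * ‖f‖ = ‖(z : ℂ) • f - (w : ℂ) • f‖ := by
  rw [circle_dist_eq_norm_sub, ← norm_smul, sub_smul]

theorem operator_apply (z : Circle) (x : A) (χ : PontryaginDual A) (f : L2 A) :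
    operator z x χ f = (z : ℂ) • translation x (modulation χ f) := rfl

theorem operator_mul_left (w z : Circle) (x : A) (χ : PontryaginDual A) (f : L2 A) :
    operator (w * z) x χ f = (w : ℂ) • operator z x χ f := by
  rw [operator_apply, operator_apply, smul_smul, Circle.coe_mul]

theorem operator_eq_smul (z : Circle) (x : A) (χ : PontryaginDual A) (f : L2 A) :
    operator z x χ f = (z : ℂ) • operator 1 x χ f := by
  rw [← operator_mul_left, mul_one]

theorem operator_operator (p q : Circle × A × PontryaginDual A) (f : L2 A) :
    operator p.1 p.2.1 p.2.2 (operator q.1 q.2.1 q.2.2 f) =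
      ((p.2.2 q.2.1 * (q.2.2 p.2.1)⁻¹ : Circle) : ℂ) •
        operator q.1 q.2.1 q.2.2 (operator p.1 p.2.1 p.2.2 f) := by
  obtain ⟨z, x, χ⟩ := p
  obtain ⟨w, y, ψ⟩ := q
  change (operator z x χ * operator w y ψ) f =
    ((χ y * (ψ x)⁻¹ : Circle) : ℂ) • (operator w y ψ * operator z x χ) f
  have phase_eq : z * w * χ y = χ y * (ψ x)⁻¹ * (w * z * ψ x) := by
    rw [mul_comm (w * z), ← mul_assoc, inv_mul_cancel_right, mul_comm w, mul_comm]
  rw [operator_mul, operator_mul, ← operator_mul_left, mul_comm y, mul_comm ψ, phase_eq]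

theorem continuous_translation {Z : Type*} [TopologicalSpace Z] {x : Z → A} {f : Z → L2 A}
    (hx : Continuous x) (hf : Continuous f) : Continuous fun z => translation (x z) (f z) := by
  let g : Z → C(A, A) := fun z => ⟨fun y => (x z)⁻¹ * y, by fun_prop⟩
  have continuous_g : Continuous g :=
    ContinuousMap.continuous_of_continuous_uncurry g (by
      change Continuous fun p : Z × A => (x p.1)⁻¹ * p.2
      fun_prop)
  exact hf.compMeasurePreservingLp continuous_g
    (fun z => measurePreserving_mul_left (Measure.haar : Measure A) (x z)⁻¹) (by norm_num)

theorem norm_modulation_sub_le {χ ψ : PontryaginDual A} {f : L2 A} {C : Set A} {δ : ℝ}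
    (hf : ∀ᵐ y ∂Measure.haar, y ∉ C → f y = 0) (hδ : ∀ y ∈ C, dist (χ y) (ψ y) ≤ δ) :
    ‖modulation χ f - modulation ψ f‖ ≤ δ * ‖f‖ := by
  refine Lp.norm_le_mul_norm_of_ae_le_mul ?_
  filter_upwards [Lp.coeFn_sub (modulation χ f) (modulation ψ f), coeFn_modulation χ f,
    coeFn_modulation ψ f, hf] with y hsub hχ hψ hfy
  rw [hsub, Pi.sub_apply, hχ, hψ, ← sub_mul, norm_mul, ← circle_dist_eq_norm_sub]
  by_cases hy : y ∈ C
  · exact mul_le_mul_of_nonneg_right (hδ y hy) (norm_nonneg _)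
  · rw [hfy hy, norm_zero, mul_zero, mul_zero]

theorem exists_compact_norm_sub_le [NormalSpace A] (f : L2 A) {ε : ℝ} (hε : 0 < ε) :
    ∃ (C : Set A) (g : L2 A), IsCompact C ∧ (∀ᵐ y ∂Measure.haar, y ∉ C → g y = 0) ∧
      ‖f - g‖ ≤ ε := by
  obtain ⟨g, compact_support, approx, -, memLp_g⟩ :=
    (Lp.memLp f).exists_hasCompactSupport_eLpNorm_sub_le
      (by norm_num) (ε := ENNReal.ofReal ε) (by simpa using hε)
  refine ⟨tsupport g, memLp_g.toLp g, compact_support, ?_, ?_⟩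
  · filter_upwards [memLp_g.coeFn_toLp] with y hy hyg
    rw [hy, image_eq_zero_of_notMem_tsupport hyg]
  · rw [← Lp.toLp_coeFn f (Lp.memLp f), ← MemLp.toLp_sub, Lp.norm_toLp]
    exact ENNReal.toReal_le_of_le_ofReal hε.le approx

theorem continuous_modulation [NormalSpace A] (f : L2 A) :
    Continuous fun χ => modulation χ f := by
  rw [continuous_iff_continuousAt]
  intro χ₀
  rw [ContinuousAt, Metric.tendsto_nhds]
  intro ε hε
  obtain ⟨C, g, compact_C, hg, norm_sub_g⟩ := exists_compact_norm_sub_le f (ε := ε / 4)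
    (by positivity)
  have near_χ₀ := Metric.tendstoUniformlyOn_iff.1
    (tendsto_pontryaginDual_iff.1 (tendsto_id (x := 𝓝 χ₀)) C compact_C)
    (ε / (4 * (‖g‖ + 1))) (by positivity)
  filter_upwards [near_χ₀] with χ hχ
  have norm_g : ‖modulation χ g - modulation χ₀ g‖ ≤ ε / 4 := by
    refine (norm_modulation_sub_le hg fun y hy => dist_comm (χ₀ y) _ ▸ (hχ y hy).le).trans ?_
    rw [div_mul_eq_mul_div, div_le_div_iff₀ (by positivity) (by positivity)]
    nlinarith [norm_nonneg g]
  have decomposition : modulation χ f - modulation χ₀ f = modulation χ (f - g) +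
      (modulation χ g - modulation χ₀ g) - modulation χ₀ (f - g) := by
    rw [map_sub, map_sub]
    abel
  rw [dist_eq_norm, decomposition]
  calc _ ≤ ‖modulation χ (f - g)‖ + ‖modulation χ g - modulation χ₀ g‖ +
        ‖modulation χ₀ (f - g)‖ := (norm_sub_le _ _).trans (by gcongr; exact norm_add_le _ _)
    _ ≤ ε / 4 + ε / 4 + ε / 4 := by
      rw [LinearIsometryEquiv.norm_map, LinearIsometryEquiv.norm_map]
      gcongr
    _ < ε := by linarith

theorem continuous_operator [NormalSpace A] (f : L2 A) :
    Continuous fun p : Circle × A × PontryaginDual A => operator p.1 p.2.1 p.2.2 f :=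
  (continuous_subtype_val.comp continuous_fst).smul (continuous_translation continuous_snd.fst
    ((continuous_modulation f).comp continuous_snd.snd))

theorem continuous_operator_one [NormalSpace A] (f : L2 A) :
    Continuous fun q : A × PontryaginDual A => operator 1 q.1 q.2 f :=
  (continuous_operator f).comp (f := fun q : A × PontryaginDual A => ((1 : Circle), q))
    (continuous_const.prodMk continuous_id)

theorem exists_ne_zero : ∃ f : L2 A, f ≠ 0 := by
  obtain ⟨C, hC, hC1⟩ := exists_compact_mem_nhds (1 : A)
  have measure_ne_top : (Measure.haar : Measure A) (interior C) ≠ ⊤ :=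
    ((measure_mono interior_subset).trans_lt hC.measure_lt_top).ne
  refine ⟨indicatorConstLp 2 isOpen_interior.measurableSet measure_ne_top 1, ?_⟩
  rw [← norm_ne_zero_iff, norm_indicatorConstLp (by norm_num) (by norm_num), norm_one, one_mul]
  refine (Real.rpow_pos_of_pos (ENNReal.toReal_pos ?_ measure_ne_top) _).ne'
  exact (isOpen_interior.measure_pos _ ⟨1, mem_interior_iff_mem_nhds.2 hC1⟩).ne'

variable (A) in
/-- The commutator bicharacter of the standard Heisenberg group of `A`, on its phase space. -/
noncomputable def standardForm (p q : A × PontryaginDual A) : Circle := q.2 p.1 * (p.2 q.1)⁻¹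

/-- Two phase space operators commute up to `standardForm`, so the form is determined by the
operators, uniformly near any given `q₀`. -/
theorem dist_standardForm_mul_norm_le (p r : Circle × A × PontryaginDual A)
    (q q₀ : A × PontryaginDual A) (f : L2 A) :
    dist (standardForm A q p.2) (standardForm A q r.2) * ‖f‖ ≤
      2 * ‖operator 1 q.1 q.2 f - operator 1 q₀.1 q₀.2 f‖ +
        ‖operator r.1 r.2.1 r.2.2 (operator 1 q₀.1 q₀.2 f) -
          operator p.1 p.2.1 p.2.2 (operator 1 q₀.1 q₀.2 f)‖ +
        ‖operator r.1 r.2.1 r.2.2 f - operator p.1 p.2.1 p.2.2 f‖ := by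
  let V := operator (1 : Circle) q.1 q.2
  let V₀ := operator (1 : Circle) q₀.1 q₀.2
  let P := operator p.1 p.2.1 p.2.2
  let R := operator r.1 r.2.1 r.2.2
  let c := standardForm A q p.2
  let d := standardForm A q r.2
  have commute_P : P (V f) = (c : ℂ) • V (P f) := operator_operator p (1, q) f
  have commute_R : R (V f) = (d : ℂ) • V (R f) := operator_operator r (1, q) f
  have decomposition : (c : ℂ) • V (P f) - (d : ℂ) • V (P f) =
      (P (V f - V₀ f) - R (V f - V₀ f)) - (R (V₀ f) - P (V₀ f)) + (d : ℂ) • V (R f - P f) := by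
    rw [← commute_P, map_sub, map_sub, map_sub, smul_sub, ← commute_R]
    abel
  calc dist c d * ‖f‖ = ‖(c : ℂ) • V (P f) - (d : ℂ) • V (P f)‖ := by
        rw [← dist_mul_norm, LinearIsometryEquiv.norm_map, LinearIsometryEquiv.norm_map]
    _ ≤ ‖P (V f - V₀ f)‖ + ‖R (V f - V₀ f)‖ + ‖R (V₀ f) - P (V₀ f)‖ +
          ‖(d : ℂ) • V (R f - P f)‖ := by
        rw [decomposition]
        refine (norm_add_le _ _).trans ?_
        gcongr
        refine (norm_sub_le _ _).trans ?_
        gcongr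
        exact norm_sub_le _ _
    _ = 2 * ‖V f - V₀ f‖ + ‖R (V₀ f) - P (V₀ f)‖ + ‖R f - P f‖ := by
        rw [norm_circle_smul, LinearIsometryEquiv.norm_map, LinearIsometryEquiv.norm_map,
          LinearIsometryEquiv.norm_map, two_mul]

section Tendsto

variable {ι : Type*} {l : Filter ι} {p : ι → Circle × A × PontryaginDual A}
  {p₀ : Circle × A × PontryaginDual A}

theorem tendsto_flat_of_tendsto_operator [NormalSpace A]
    (hn : IsNondegenerateBicharacter (standardForm A))
    (h : ∀ f : L2 A, Tendsto (fun i => operator (p i).1 (p i).2.1 (p i).2.2 f) l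
      (𝓝 (operator p₀.1 p₀.2.1 p₀.2.2 f))) :
    Tendsto (fun i => hn.flat (p i).2) l (𝓝 (hn.flat p₀.2)) := by
  obtain ⟨f, hf⟩ := exists_ne_zero (A := A)
  have norm_pos : 0 < ‖f‖ := norm_pos_iff.2 hf
  rw [tendsto_pontryaginDual_iff]
  intro C hC
  rw [← tendstoLocallyUniformlyOn_iff_tendstoUniformlyOn_of_compact hC]
  refine Metric.tendstoLocallyUniformlyOn_iff.2 fun ε hε q₀ _ => ?_
  refine ⟨{q | dist (operator 1 q.1 q.2 f) (operator 1 q₀.1 q₀.2 f) < ε * ‖f‖ / 4},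
    mem_nhdsWithin_of_mem_nhds
      (Metric.tendsto_nhds.1 (continuous_operator_one f).continuousAt _ (by positivity)), ?_⟩
  filter_upwards [Metric.tendsto_nhds.1 (h f) (ε * ‖f‖ / 4) (by positivity),
    Metric.tendsto_nhds.1 (h (operator 1 q₀.1 q₀.2 f)) (ε * ‖f‖ / 4) (by positivity)]
    with i near_f near_q₀ q near_q
  change dist _ _ < _ at near_q
  rw [dist_eq_norm] at near_f near_q₀ near_q
  rw [hn.flat_apply, hn.flat_apply]
  refine lt_of_mul_lt_mul_right ?_ norm_pos.le
  have := dist_standardForm_mul_norm_le p₀ (p i) q q₀ f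
  linarith

theorem tendsto_phase_of_tendsto_operator [NormalSpace A]
    (h : ∀ f : L2 A, Tendsto (fun i => operator (p i).1 (p i).2.1 (p i).2.2 f) l
      (𝓝 (operator p₀.1 p₀.2.1 p₀.2.2 f)))
    (hp : Tendsto (fun i => (p i).2) l (𝓝 p₀.2)) :
    Tendsto (fun i => (p i).1) l (𝓝 p₀.1) := by
  obtain ⟨f, hf⟩ := exists_ne_zero (A := A)
  have norm_pos : 0 < ‖f‖ := norm_pos_iff.2 hf
  rw [Metric.tendsto_nhds]
  intro ε hε
  filter_upwards [Metric.tendsto_nhds.1 (h f) (ε * ‖f‖ / 2) (by positivity),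
    Metric.tendsto_nhds.1 (((continuous_operator_one f).tendsto _).comp hp) (ε * ‖f‖ / 2)
      (by positivity)] with i near near_one
  rw [Function.comp_apply, dist_eq_norm] at near_one
  rw [dist_eq_norm, operator_eq_smul, operator_eq_smul p₀.1] at near
  set g := operator (1 : Circle) (p i).2.1 (p i).2.2 f
  set g₀ := operator (1 : Circle) p₀.2.1 p₀.2.2 f with hg₀
  refine lt_of_mul_lt_mul_right ?_ norm_pos.le
  calc dist (p i).1 p₀.1 * ‖f‖ = ‖((p i).1 : ℂ) • g₀ - (p₀.1 : ℂ) • g₀‖ := by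
        rw [← dist_mul_norm, hg₀, LinearIsometryEquiv.norm_map]
    _ = ‖(((p i).1 : ℂ) • g - (p₀.1 : ℂ) • g₀) - ((p i).1 : ℂ) • (g - g₀)‖ := by
        rw [smul_sub]
        abel_nf
    _ ≤ ‖((p i).1 : ℂ) • g - (p₀.1 : ℂ) • g₀‖ + ‖g - g₀‖ := by
        rw [← norm_circle_smul (p i).1 (g - g₀)]
        exact norm_sub_le _ _
    _ < ε * ‖f‖ := by linarith

theorem tendsto_of_tendsto_operator [NormalSpace A]
    (hn : IsNondegenerateBicharacter (standardForm A))
    (h : ∀ f : L2 A, Tendsto (fun i => operator (p i).1 (p i).2.1 (p i).2.2 f) l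
      (𝓝 (operator p₀.1 p₀.2.1 p₀.2.2 f))) : Tendsto p l (𝓝 p₀) := by
  have tendsto_snd : Tendsto (fun i => (p i).2) l (𝓝 p₀.2) :=
    hn.flat.toHomeomorph.isInducing.tendsto_nhds_iff.2 (tendsto_flat_of_tendsto_operator hn h)
  exact (tendsto_phase_of_tendsto_operator h tendsto_snd).prodMk_nhds tendsto_snd

end Tendsto

theorem isInducing_standardGroup_apply :
    IsInducing fun (U : standardGroup A) (f : L2 A) => (U : L2 A ≃ₗᵢ[ℂ] L2 A) f :=
  IsInducing.comp (g := fun (U : L2 A ≃ₗᵢ[ℂ] L2 A) (f : L2 A) => U f) ⟨rfl⟩ ⟨rfl⟩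

theorem coe_element (z : Circle) (x : A) (χ : PontryaginDual A) :
    (element z x χ : L2 A ≃ₗᵢ[ℂ] L2 A) = operator z x χ := rfl

theorem isInducing_element [NormalSpace A]
    (hn : IsNondegenerateBicharacter (standardForm A)) :
    IsInducing fun p : Circle × A × PontryaginDual A => element p.1 p.2.1 p.2.2 := by
  refine isInducing_iff_nhds.2 fun p => le_antisymm (Tendsto.le_comap ?_) ?_
  · exact (isInducing_standardGroup_apply.continuous_iff.2
      (continuous_pi fun f => continuous_operator f)).tendsto p
  · refine tendsto_id'.1 (tendsto_of_tendsto_operator (p := fun q => q) hn fun f => ?_)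
    simp only [← coe_element]
    have continuous_apply_f :
        Continuous fun U : standardGroup A => (U : L2 A ≃ₗᵢ[ℂ] L2 A) f :=
      (continuous_apply f).comp isInducing_standardGroup_apply.continuous
    exact (continuous_apply_f.tendsto _).comp tendsto_comap

theorem exists_homeomorph_standardGroup [T4Space A]
    (hn : IsNondegenerateBicharacter (standardForm A)) :
    ∃ Θ : Circle × A × PontryaginDual A ≃ₜ standardGroup A,
      ∀ z x χ, Θ (z, x, χ) = element z x χ := by
  have surjective_element : Function.Surjective
      fun p : Circle × A × PontryaginDual A => element p.1 p.2.1 p.2.2 := by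
    rintro ⟨_, z, x, χ, rfl⟩
    exact ⟨(z, x, χ), rfl⟩
  exact ⟨(isInducing_element hn).isEmbedding.toHomeomorphOfSurjective surjective_element,
    fun _ _ _ => rfl⟩

theorem element_mul (z z' : Circle) (x x' : A) (χ χ' : PontryaginDual A) :
    element z x χ * element z' x' χ' = element (z * z' * χ x') (x * x') (χ * χ') :=
  Subtype.ext (operator_mul z z' x x' χ χ')

end Heisenberg

section CentralExtension

theorem IsCommutatorForm.mul_comm_mul {G K : Type*} [Group G] [CommGroup K]
    {S : GroupExtension Circle G K} {e : K → K → Circle} (he : IsCommutatorForm S e) (g h : G) :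
    g * h = S.inl (e (S.rightHom g) (S.rightHom h)) * (h * g) := by
  rw [he]
  group

variable {G K : Type*} [Group G] [TopologicalSpace G] [CommGroup K] [TopologicalSpace K]
  {S : GroupExtension Circle G K}

theorem IsCommutatorForm.isAlternatingBicharacter {e : K → K → Circle} (he : IsCommutatorForm S e)
    (hS : IsTopologicalCentralExtension S) : IsAlternatingBicharacter e := by
  have swap (k l : K) : e l k = (e k l)⁻¹ := by
    obtain ⟨g, rfl⟩ := S.rightHom_surjective k
    obtain ⟨h, rfl⟩ := S.rightHom_surjective l
    refine S.inl_injective ?_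
    rw [map_inv, he, he]
    group
  have mul_left (k k' l : K) : e (k * k') l = e k l * e k' l := by
    obtain ⟨g, rfl⟩ := S.rightHom_surjective k
    obtain ⟨g', rfl⟩ := S.rightHom_surjective k'
    obtain ⟨h, rfl⟩ := S.rightHom_surjective l
    refine S.inl_injective ?_
    rw [← map_mul, he, mul_comm, map_mul, he g h]
    calc g * g' * h * (g * g')⁻¹ * h⁻¹ = g * (g' * h * g'⁻¹ * h⁻¹) * (h * g⁻¹ * h⁻¹) := by group
      _ = S.inl (e (S.rightHom g') (S.rightHom h)) * g * (h * g⁻¹ * h⁻¹) := by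
        rw [← he, hS.central]
      _ = _ := by group
  refine ⟨mul_left, fun k l l' => ?_, fun k => S.inl_injective ?_⟩
  · rw [swap (l * l'), mul_left, mul_inv, ← swap, ← swap]
  · obtain ⟨g, rfl⟩ := S.rightHom_surjective k
    rw [he, map_one]
    group

theorem IsTopologicalCentralExtension.exists_homeomorph_of_section [IsTopologicalGroup G]
    [T2Space G] (hS : IsTopologicalCentralExtension S) {s : K → G} (hs : Continuous s)
    (hπs : ∀ k, S.rightHom (s k) = k) :
    ∃ Φ : Circle × K ≃ₜ G, ∀ z k, Φ (z, k) = S.inl z * s k := by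
  have exists_phase (g : G) : ∃ z, S.inl z = g * (s (S.rightHom g))⁻¹ :=
    exists_inl_eq_of_rightHom_eq_one S (by rw [map_mul, map_inv, hπs, mul_inv_cancel])
  choose phase inl_phase using exists_phase
  have continuous_rightHom : Continuous S.rightHom := hS.isOpenQuotientMap_rightHom.continuous
  have continuous_phase : Continuous phase :=
    hS.isClosedEmbedding_inl.isInducing.continuous_iff.2
      ((continuous_id.mul (hs.comp continuous_rightHom).inv).congr fun g => (inl_phase g).symm)
  have rightHom_mul (z : Circle) (k : K) : S.rightHom (S.inl z * s k) = k := by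
    rw [map_mul, GroupExtension.rightHom_inl, one_mul, hπs]
  refine ⟨{ toFun := fun p => S.inl p.1 * s p.2
            invFun := fun g => (phase g, S.rightHom g)
            left_inv := fun p => Prod.ext (S.inl_injective ?_) (rightHom_mul p.1 p.2)
            right_inv := fun g => ?_
            continuous_toFun := (hS.continuous_inl.comp continuous_fst).mul
              (hs.comp continuous_snd)
            continuous_invFun := continuous_phase.prodMk continuous_rightHom },
    fun _ _ => rfl⟩
  · rw [inl_phase, rightHom_mul, mul_inv_cancel_right]
  · change S.inl (phase g) * s (S.rightHom g) = g
    rw [inl_phase, inv_mul_cancel_right]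

theorem IsCommutatorForm.exists_lift {G : Type v} [Group G] [TopologicalSpace G]
    [IsTopologicalGroup G] [T2Space G] {K : Type u} [CommGroup K] [TopologicalSpace K]
    {S : GroupExtension Circle G K} (hS : IsTopologicalCentralExtension S) {e : K → K → Circle}
    (he : IsCommutatorForm S e) {A : Type} [CommGroup A] [TopologicalSpace A]
    (hA : HasLifts.{u, v} A) {α : A →ₜ* K} (hα : ∀ a b, e (α a) (α b) = 1) :
    ∃ σ : A →ₜ* G, ∀ a, S.rightHom (σ a) = α a := by
  refine hA K G S hS α fun a b g h hg hh => ?_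
  have commute_form := he.mul_comm_mul g h
  rwa [hg, hh, hα, map_one, one_mul] at commute_form

end CentralExtension

section Comparison

variable {A : Type*} [CommGroup A] [TopologicalSpace A] {G K : Type*} [Group G]
  [TopologicalSpace G] [CommGroup K] [TopologicalSpace K] {S : GroupExtension Circle G K}

theorem IsTopologicalCentralExtension.mul_mul_mul_of_weyl_relation
    (hS : IsTopologicalCentralExtension S) {σ : A →ₜ* G} {τ : PontryaginDual A →ₜ* G}
    (hστ : ∀ x χ, τ χ * σ x = S.inl (χ x) * (σ x * τ χ))
    (z z' : Circle) (x x' : A) (χ χ' : PontryaginDual A) :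
    S.inl z * (σ x * τ χ) * (S.inl z' * (σ x' * τ χ')) =
      S.inl (z * z' * χ x') * (σ (x * x') * τ (χ * χ')) := by
  rw [map_mul σ, map_mul τ, map_mul S.inl, map_mul S.inl]
  calc S.inl z * (σ x * τ χ) * (S.inl z' * (σ x' * τ χ')) =
        S.inl z * (σ x * τ χ * S.inl z') * (σ x' * τ χ') := by simp only [mul_assoc]
    _ = S.inl z * S.inl z' * σ x * (τ χ * σ x') * τ χ' := by
      rw [← hS.central]; simp only [mul_assoc]
    _ = S.inl z * S.inl z' * (σ x * S.inl (χ x')) * (σ x' * τ χ * τ χ') := by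
      rw [hστ]; simp only [mul_assoc]
    _ = _ := by rw [← hS.central (χ x') (σ x)]; simp only [mul_assoc]

theorem IsTopologicalCentralExtension.exists_equiv_standardGroup [IsTopologicalGroup A]
    [LocallyCompactSpace A] [T4Space A] [MeasurableSpace A] [BorelSpace A] [IsTopologicalGroup G]
    [T2Space G] (hS : IsTopologicalCentralExtension S)
    (hn : IsNondegenerateBicharacter (Heisenberg.standardForm A)) (φ : A × PontryaginDual A ≃ₜ* K)
    {σ : A →ₜ* G} {τ : PontryaginDual A →ₜ* G} (hφ : ∀ x χ, S.rightHom (σ x * τ χ) = φ (x, χ))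
    (hστ : ∀ x χ, τ χ * σ x = S.inl (χ x) * (σ x * τ χ)) :
    ∃ Ψ : Heisenberg.standardGroup A ≃ₜ* G,
      ∀ z x χ, Ψ (Heisenberg.element z x χ) = S.inl z * (σ x * τ χ) := by
  obtain ⟨Θ, hΘ⟩ := Heisenberg.exists_homeomorph_standardGroup hn
  obtain ⟨Φ, hΦ⟩ := hS.exists_homeomorph_of_section
    (s := fun k => σ (φ.symm k).1 * τ (φ.symm k).2)
    (((map_continuous σ).comp (map_continuous φ.symm).fst).mul
      ((map_continuous τ).comp (map_continuous φ.symm).snd))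
    fun k => (hφ _ _).trans (φ.apply_symm_apply k)
  let F := Θ.symm.trans (((Homeomorph.refl Circle).prodCongr φ.toHomeomorph).trans Φ)
  have F_element (z : Circle) (x : A) (χ : PontryaginDual A) :
      F (Heisenberg.element z x χ) = S.inl z * (σ x * τ χ) := by
    have symm_element : Θ.symm (Heisenberg.element z x χ) = (z, x, χ) :=
      Θ.symm_apply_eq.2 (hΘ z x χ).symm
    change Φ ((Θ.symm (Heisenberg.element z x χ)).1, φ (Θ.symm (Heisenberg.element z x χ)).2) = _
    rw [symm_element, hΦ, φ.symm_apply_apply]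
  refine ⟨.mk' F ?_, F_element⟩
  rintro ⟨_, z, x, χ, rfl⟩ ⟨_, z', x', χ', rfl⟩
  change F (Heisenberg.element z x χ * Heisenberg.element z' x' χ') =
    F (Heisenberg.element z x χ) * F (Heisenberg.element z' x' χ')
  rw [Heisenberg.element_mul, F_element, F_element, F_element,
    hS.mul_mul_mul_of_weyl_relation hστ]

end Comparison

theorem HasPolarization.exists_weyl_lifts {K : Type u} [CommGroup K] [TopologicalSpace K]
    {e : K → K → Circle} (hpol : HasPolarization.{u, v} e) (he : IsAlternatingBicharacter e)
    (hn : IsNondegenerateBicharacter e) {G : Type v} [Group G]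
    [TopologicalSpace G] [IsTopologicalGroup G] [T2Space G] {S : GroupExtension Circle G K}
    (hS : IsTopologicalCentralExtension S) (hcomm : IsCommutatorForm S e) :
    ∃ (A : Type) (_ : CommGroup A) (_ : TopologicalSpace A), IsEuclideanTimesDiscrete A ∧
      IsNondegenerateBicharacter (Heisenberg.standardForm A) ∧
      ∃ (φ : A × PontryaginDual A ≃ₜ* K) (σ : A →ₜ* G) (τ : PontryaginDual A →ₜ* G),
        (∀ x χ, S.rightHom (σ x * τ χ) = φ (x, χ)) ∧
        ∀ x χ, τ χ * σ x = S.inl (χ x) * (σ x * τ χ) := by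
  obtain ⟨A, _, _, hA, liftsA, liftsDual, φ₀, hφ₀⟩ := hpol
  have nondegenerate_standardForm : IsNondegenerateBicharacter (Heisenberg.standardForm A) := by
    have form_eq : (fun p q => e (φ₀ p) (φ₀ q)) = Heisenberg.standardForm A :=
      funext₂ fun p q => hφ₀ p.1 q.1 p.2 q.2
    exact form_eq ▸ hn.comp he φ₀
  let inv : PontryaginDual A ≃ₜ* PontryaginDual A := .mk' (Homeomorph.inv _) mul_inv
  -- Inverting the dual variable turns the polarization into one for the opposite form.
  let φ : A × PontryaginDual A ≃ₜ* K := (prodCongrContinuous (.refl A) inv).trans φ₀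
  have form_eq (p q : A × PontryaginDual A) : e (φ p) (φ q) = p.2 q.1 * (q.2 p.1)⁻¹ := by
    refine (hφ₀ p.1 q.1 p.2⁻¹ q.2⁻¹).trans ?_
    change (q.2 p.1)⁻¹ * ((p.2 q.1)⁻¹)⁻¹ = _
    rw [inv_inv, mul_comm]
  obtain ⟨σ, hσ⟩ := hcomm.exists_lift hS liftsA
    (α := (φ : A × PontryaginDual A →ₜ* K).comp (.inl A (PontryaginDual A)))
    fun a b => (form_eq (a, 1) (b, 1)).trans (by simp)
  obtain ⟨τ, hτ⟩ := hcomm.exists_lift hS liftsDual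
    (α := (φ : A × PontryaginDual A →ₜ* K).comp (.inr A (PontryaginDual A)))
    fun a b => (form_eq (1, a) (1, b)).trans (by simp)
  have rightHom_σ (x : A) : S.rightHom (σ x) = φ (x, 1) := hσ x
  have rightHom_τ (χ : PontryaginDual A) : S.rightHom (τ χ) = φ (1, χ) := hτ χ
  refine ⟨A, _, _, hA, nondegenerate_standardForm, φ, σ, τ, fun x χ => ?_, fun x χ => ?_⟩
  · rw [map_mul, rightHom_σ, rightHom_τ, ← map_mul, Prod.mk_mul_mk, mul_one, one_mul]
  · rw [hcomm.mul_comm_mul, rightHom_σ, rightHom_τ, form_eq]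
    simp

theorem IsHeisenbergGroup.exists_equiv_standardGroup {K : Type u} [CommGroup K]
    [TopologicalSpace K] (hK : IsLieGroup K) {G : Type v} [Group G] [TopologicalSpace G]
    [IsTopologicalGroup G] [T2Space G] {S : GroupExtension Circle G K}
    (hG : IsHeisenbergGroup S) :
    ∃ (A : Type) (_ : CommGroup A) (_ : TopologicalSpace A) (_ : IsTopologicalGroup A)
      (_ : LocallyCompactSpace A) (_ : MeasurableSpace A) (_ : BorelSpace A), IsLieGroup A ∧
      ∃ (φ : (A × PontryaginDual A) ≃ₜ* K) (Ψ : Heisenberg.standardGroup A ≃ₜ* G),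
        (∀ z : Circle, Ψ (Heisenberg.element z 1 1) = S.inl z) ∧
        ∀ (z : Circle) (x : A) (χ : PontryaginDual A),
          S.rightHom (Ψ (Heisenberg.element z x χ)) = φ (x, χ) := by
  obtain ⟨hS, e, hcomm, hn⟩ := hG
  have he := hcomm.isAlternatingBicharacter hS
  obtain ⟨A, _, _, hA, standard_nondegenerate, φ, σ, τ, hφ, hστ⟩ :=
    (hK.hasPolarization he hn).exists_weyl_lifts he hn hS hcomm
  have := hA.isTopologicalGroup
  have := hA.locallyCompactSpace
  have := hA.t4Space
  let _ : MeasurableSpace A := borel A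
  have : BorelSpace A := ⟨rfl⟩
  obtain ⟨Ψ, hΨ⟩ := hS.exists_equiv_standardGroup standard_nondegenerate φ hφ hστ
  refine ⟨A, _, _, inferInstance, inferInstance, inferInstance, inferInstance, hA.isLieGroup,
    φ, Ψ, fun z => ?_, fun z x χ => ?_⟩
  · rw [hΨ, map_one, map_one, mul_one, mul_one]
  · rw [hΨ, map_mul, GroupExtension.rightHom_inl, one_mul, hφ]

theorem theoremA {K : Type*} [CommGroup K] [TopologicalSpace K] (hK : IsLieGroup K) :
    (∀ e : K → K → Circle, IsAlternatingBicharacter e → IsNondegenerateBicharacter e →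
      ∃ (A : Type) (_ : CommGroup A) (_ : TopologicalSpace A), IsLieGroup A ∧
        ∃ φ : (A × PontryaginDual A) ≃ₜ* K, ∀ (x x' : A) (χ χ' : PontryaginDual A),
          e (φ (x, χ)) (φ (x', χ')) = χ' x * (χ x')⁻¹) ∧
    (∀ (G : Type*) [Group G] [TopologicalSpace G] [IsTopologicalGroup G] [T2Space G]
      [LocallyCompactSpace G] (S : GroupExtension Circle G K), IsHeisenbergGroup S →
      ∃ (A : Type) (_ : CommGroup A) (_ : TopologicalSpace A) (_ : IsTopologicalGroup A)
        (_ : LocallyCompactSpace A) (_ : MeasurableSpace A) (_ : BorelSpace A), IsLieGroup A ∧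
        ∃ (φ : (A × PontryaginDual A) ≃ₜ* K) (Ψ : Heisenberg.standardGroup A ≃ₜ* G),
          (∀ z : Circle, Ψ (Heisenberg.element z 1 1) = S.inl z) ∧
          ∀ (z : Circle) (x : A) (χ : PontryaginDual A),
            S.rightHom (Ψ (Heisenberg.element z x χ)) = φ (x, χ)) := by
  refine ⟨fun e he hn => ?_, fun _ _ _ _ _ _ _ hG => hG.exists_equiv_standardGroup hK⟩
  obtain ⟨A, _, _, hA, -, -, φ, hφ⟩ := IsLieGroup.hasPolarization.{_, 0} hK he hn
  exact ⟨A, _, _, hA.isLieGroup, φ, hφ⟩
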